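/- Let $l$ be an integer with $2l>3$, let $\Omega\subset\mathbb R^3$ be a bounded domain (open and connected) with boundary of class $C^{l+2}$, let $H^k(\Omega)=W^{k,2}(\Omega)$, and let $\mu\in H^{l+1}(\Omega)$ and $\lambda\in L^2(\Omega)$. For a vector field $\mathbf u$ write $\varepsilon(\mathbf u)=\frac12(\nabla\mathbf u+\nabla\mathbf u^{\top})$. Let $\mathbf u_1\neq\mathbf u_2$ in $H^{l+2}(\Omega)^3$ be two quasi-static elastic deformations generated by different force densities $\mathbf F_1\neq\mathbf F_2$ in $L^2(\Omega)^3$, i.e. for $k=1,2$ $$\nabla(\lambda\,\nabla\cdot\mathbf u_k)+2\,\nabla\cdot(\mu\,\varepsilon(\mathbf u_k))=\mathbf F_k\ \text{ on }\Omega,\qquad \mathbf u_k|_{\partial\Omega}=0,$$ the first equation being understood in the sense of distributions. Assume the nonsingular-strain condition: for every $x\in\Omega$, $\det\varepsilon(\mathbf u_k)(x)\neq0$ for at least one $k\in\{1,2\}$ (point values and boundary values being those of the continuous representatives). Consider on $H^{l+1}(\Omega)\times H^{l+2}(\Omega)^3\times H^{l+2}(\Omega)^3$ the two-measurement linearized operator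 $$\mathcal A_\mu^{(2)}(\delta\mu,\delta\mathbf u_1,\delta\mathbf u_2)=\bigl(\mathcal L^{(1)}_\mu(\delta\mu,\delta\mathbf u_1),\ \delta\mathbf u_1|_{\partial\Omega},\ \mathcal L^{(2)}_\mu(\delta\mu,\delta\mathbf u_2),\ \delta\mathbf u_2|_{\partial\Omega}\bigr),$$ $$\mathcal L^{(k)}_\mu(\delta\mu,\delta\mathbf u_k)=\bigl(2\,\nabla\cdot(\delta\mu\,\varepsilon(\mathbf u_k))+2\,\nabla\cdot(\mu\,\varepsilon(\delta\mathbf u_k)),\ \delta\mathbf u_k\bigr).$$ Then $\ker\mathcal A_\mu^{(2)}=\{(0,0,0)\}$, and $\mathcal A_\mu^{(2)}$ is injective. -/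

import Mathlib

open MeasureTheory Topology TopologicalSpace
open scoped Distributions

namespace Elastography

noncomputable section

/-- Three-dimensional Euclidean space. -/
abbrev E3 : Type := EuclideanSpace ℝ (Fin 3)

/-- The `i`-th coordinate vector of `ℝ³`. -/
def basisVec (i : Fin 3) : E3 := EuclideanSpace.single i 1

/-- The (real) Hilbert space `L²(Ω)` of almost-everywhere classes of functions on `Ω`. -/
abbrev L2 (Ω : Opens E3) : Type := Lp ℝ 2 (volume.restrict (Ω : Set E3))

/-- `Ω` has boundary of class `C^k`: near each boundary point, after a rotation or reflection `L`
of the coordinate axes, `Ω` is the part of space lying strictly above the graph of a `C^k`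
function of two variables. -/
def HasCkBoundary (k : ℕ) (Ω : Opens E3) : Prop :=
  ∀ x ∈ frontier (Ω : Set E3), ∃ r > 0,
    ∃ (L : E3 ≃ₗᵢ[ℝ] WithLp 2 (EuclideanSpace ℝ (Fin 2) × ℝ)) (γ : EuclideanSpace ℝ (Fin 2) → ℝ),
      ContDiff ℝ k γ ∧
        ∀ y ∈ Metric.ball x r, y ∈ Ω ↔ γ (L y).fst < (L y).snd

/-! ### Distributions and Sobolev spaces -/

/-- The distribution `φ ↦ ∫_Ω φ f` given by a locally integrable function `f` on `Ω`. -/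
def toDist (Ω : Opens E3) (f : E3 → ℝ) : 𝓓'(Ω, ℝ) :=
  (TestFunction.integralAgainstBilinCLM (ContinuousLinearMap.mul ℝ ℝ)
    (volume.restrict (Ω : Set E3)) f : 𝓓(Ω, ℝ) →L[ℝ] ℝ)

/-- The partial derivative `∂ᵢ T` of a distribution, `(∂ᵢ T)(φ) = - T (∂ᵢ φ)`. -/
def distDeriv {Ω : Opens E3} (i : Fin 3) (T : 𝓓'(Ω, ℝ)) : 𝓓'(Ω, ℝ) :=
  (-((show 𝓓(Ω, ℝ) →L[ℝ] ℝ from T) ∘L TestFunction.lineDerivCLM ℝ (basisVec i)) :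
    𝓓(Ω, ℝ) →L[ℝ] ℝ)

/-- `g` is the `i`-th weak partial derivative of `f` on `Ω`. -/
def IsWeakDeriv {Ω : Opens E3} (i : Fin 3) (f g : L2 Ω) : Prop :=
  distDeriv i (toDist Ω f) = toDist Ω g

theorem locallyIntegrableOn_L2 {Ω : Opens E3} (f : L2 Ω) :
    LocallyIntegrableOn f (Ω : Set E3) (volume.restrict (Ω : Set E3)) :=
  ((Lp.memLp f).locallyIntegrable (by norm_num)).locallyIntegrableOn _

theorem toDist_apply {Ω : Opens E3} {f : E3 → ℝ}
    (hf : LocallyIntegrableOn f (Ω : Set E3) (volume.restrict (Ω : Set E3))) (φ : 𝓓(Ω, ℝ)) :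
    toDist Ω f φ = ∫ x in (Ω : Set E3), φ x * f x :=
  TestFunction.integralAgainstBilinCLM_eq_integral hf

theorem distDeriv_apply {Ω : Opens E3} (i : Fin 3) (T : 𝓓'(Ω, ℝ)) (φ : 𝓓(Ω, ℝ)) :
    distDeriv i T φ = -T (TestFunction.lineDerivCLM ℝ (basisVec i) φ) := rfl

theorem toDist_add {Ω : Opens E3} (f g : L2 Ω) :
    toDist Ω (f + g : L2 Ω) = toDist Ω f + toDist Ω g := by
  ext φ
  change toDist Ω (f + g : L2 Ω) φ = toDist Ω f φ + toDist Ω g φ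
  rw [toDist_apply (locallyIntegrableOn_L2 _), toDist_apply (locallyIntegrableOn_L2 _),
    toDist_apply (locallyIntegrableOn_L2 _), ← integral_add]
  · refine integral_congr_ae ?_
    filter_upwards [Lp.coeFn_add f g] with x hx
    rw [hx, Pi.add_apply, mul_add]
  · exact TestFunction.integrable_bilin (ContinuousLinearMap.mul ℝ ℝ) (locallyIntegrableOn_L2 f) φ
  · exact TestFunction.integrable_bilin (ContinuousLinearMap.mul ℝ ℝ) (locallyIntegrableOn_L2 g) φ

theorem toDist_smul {Ω : Opens E3} (c : ℝ) (f : L2 Ω) :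
    toDist Ω (c • f : L2 Ω) = c • toDist Ω f := by
  ext φ
  change toDist Ω (c • f : L2 Ω) φ = c * toDist Ω f φ
  rw [toDist_apply (locallyIntegrableOn_L2 _), toDist_apply (locallyIntegrableOn_L2 _),
    ← integral_const_mul]
  refine integral_congr_ae ?_
  filter_upwards [Lp.coeFn_smul c f] with x hx
  rw [hx, Pi.smul_apply, smul_eq_mul]
  ring

theorem distDeriv_add {Ω : Opens E3} (i : Fin 3) (S T : 𝓓'(Ω, ℝ)) :
    distDeriv i (S + T) = distDeriv i S + distDeriv i T := by
  ext φ
  change -(S _ + T _) = -S _ + -T _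
  ring

theorem distDeriv_smul {Ω : Opens E3} (i : Fin 3) (c : ℝ) (T : 𝓓'(Ω, ℝ)) :
    distDeriv i (c • T) = c • distDeriv i T := by
  ext φ
  change -(c * T _) = c * -T _
  ring

theorem IsWeakDeriv.add {Ω : Opens E3} {i : Fin 3} {f g f' g' : L2 Ω}
    (h : IsWeakDeriv i f g) (h' : IsWeakDeriv i f' g') : IsWeakDeriv i (f + f') (g + g') := by
  unfold IsWeakDeriv at *
  rw [toDist_add, toDist_add, distDeriv_add, h, h']

theorem IsWeakDeriv.smul {Ω : Opens E3} {i : Fin 3} {f g : L2 Ω} (c : ℝ)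
    (h : IsWeakDeriv i f g) : IsWeakDeriv i (c • f) (c • g) := by
  unfold IsWeakDeriv at *
  rw [toDist_smul, toDist_smul, distDeriv_smul, h]

theorem isWeakDeriv_zero {Ω : Opens E3} (i : Fin 3) : IsWeakDeriv i (0 : L2 Ω) 0 := by
  unfold IsWeakDeriv
  have h : toDist Ω ((0 : L2 Ω) : E3 → ℝ) = 0 := by
    have := toDist_smul (0 : ℝ) (0 : L2 Ω)
    rwa [zero_smul, zero_smul] at this
  rw [h]
  have := distDeriv_smul i (0 : ℝ) (0 : 𝓓'(Ω, ℝ))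
  rwa [zero_smul, zero_smul] at this

/-- The Sobolev space `H^k(Ω) = W^{k,2}(Ω)` of square-integrable functions all of whose weak
derivatives of order at most `k` are square-integrable: `H⁰ = L²`, and `f ∈ H^{k+1}` iff `f ∈ L²`
has weak first partial derivatives belonging to `H^k`. -/
def sobolev (Ω : Opens E3) : ℕ → Submodule ℝ (L2 Ω)
  | 0 => ⊤
  | k + 1 =>
    { carrier := {f | ∀ i : Fin 3, ∃ g ∈ sobolev Ω k, IsWeakDeriv i f g}
      add_mem' := fun {f f'} hf hf' i => by
        obtain ⟨g, hg, h⟩ := hf i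
        obtain ⟨g', hg', h'⟩ := hf' i
        exact ⟨g + g', (sobolev Ω k).add_mem hg hg', h.add h'⟩
      zero_mem' := fun i => ⟨0, (sobolev Ω k).zero_mem, isWeakDeriv_zero i⟩
      smul_mem' := fun c f hf i => by
        obtain ⟨g, hg, h⟩ := hf i
        exact ⟨c • g, (sobolev Ω k).smul_mem c hg, h.smul c⟩ }

open Classical in
/-- The `i`-th weak partial derivative `∂ᵢ f` of `f ∈ H¹(Ω)` as an element of `L²(Ω)`
(with value `0` if `f` has no square-integrable weak derivative; never used in that case). -/
def weakDeriv {Ω : Opens E3} (i : Fin 3) (f : L2 Ω) : L2 Ω :=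
  if h : ∃ g : L2 Ω, IsWeakDeriv i f g then h.choose else 0

/-- The value at `x ∈ closure Ω` of the continuous representative of `f`, computed as the limit of
the means of `f` over `B(x, r) ∩ Ω` as `r → 0`. -/
def pointValue {Ω : Opens E3} (f : L2 Ω) (x : E3) : ℝ :=
  Filter.limUnder (𝓝[>] (0 : ℝ)) fun r => ⨍ y in Metric.ball x r ∩ (Ω : Set E3), f y

/-! ### Strain, stress and the linearized operator -/

/-- Vector fields on `Ω` with components in `H^k(Ω)`. -/
abbrev VecSobolev (Ω : Opens E3) (k : ℕ) : Type := Fin 3 → sobolev Ω k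

/-- The strain tensor `ε(u)ᵢⱼ = (∂ᵢ uⱼ + ∂ⱼ uᵢ) / 2`. -/
def strain {Ω : Opens E3} {k : ℕ} (u : VecSobolev Ω k) (i j : Fin 3) : L2 Ω :=
  (1 / 2 : ℝ) • (weakDeriv i (u j : L2 Ω) + weakDeriv j (u i : L2 Ω))

/-- The strain tensor at the point `x`, a symmetric `3 × 3` matrix. -/
def strainAt {Ω : Opens E3} {k : ℕ} (u : VecSobolev Ω k) (x : E3) : Matrix (Fin 3) (Fin 3) ℝ :=
  Matrix.of fun i j => pointValue (strain u i j) x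

/-- The divergence `∇·u`. -/
def divergence {Ω : Opens E3} {k : ℕ} (u : VecSobolev Ω k) : L2 Ω :=
  ∑ i, weakDeriv i (u i : L2 Ω)

/-- The `i`-th component of `∇·(m ε(u))`, the column-wise divergence of the tensor field `m ε(u)`,
in the sense of distributions. -/
def divScaledStrain {Ω : Opens E3} {k : ℕ} (m : L2 Ω) (u : VecSobolev Ω k) (i : Fin 3) :
    𝓓'(Ω, ℝ) :=
  ∑ j, distDeriv j (toDist Ω fun x => m x * strain u j i x)

/-- The `i`-th component of `∇(lam ∇·u)` in the sense of distributions. -/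
def gradScaledDiv {Ω : Opens E3} {k : ℕ} (lam : L2 Ω) (u : VecSobolev Ω k) (i : Fin 3) :
    𝓓'(Ω, ℝ) :=
  distDeriv i (toDist Ω fun x => lam x * divergence u x)

/-- The boundary operator: the restriction `u|_∂Ω`. -/
def boundaryOp {Ω : Opens E3} {k : ℕ} (u : VecSobolev Ω k) :
    frontier (Ω : Set E3) → Fin 3 → ℝ :=
  fun x i => pointValue (u i : L2 Ω) x

/-- `u` is a quasi-static elastic deformation for the Lamé parameters `lam`, `mu` and the force
density `F`: `∇(lam ∇·u) + 2 ∇·(mu ε(u)) = F` on `Ω` and `u|_∂Ω = 0`. -/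
def IsQuasiStaticDeformation {Ω : Opens E3} {k : ℕ} (lam mu : L2 Ω) (F : Fin 3 → L2 Ω)
    (u : VecSobolev Ω k) : Prop :=
  (∀ i, gradScaledDiv lam u i + (2 : ℝ) • divScaledStrain mu u i = toDist Ω (F i)) ∧
    boundaryOp u = 0

/-- The linearized operator for a single measurement at the reference state `u`, in the
quasi-static case: `L_μ(δμ, δu) = (2 ∇·(δμ ε(u)) + 2 ∇·(μ ε(δu)), δu)`. -/
def linearizedL {Ω : Opens E3} {l : ℕ} (mu : L2 Ω) (u : VecSobolev Ω (l + 2))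
    (dmu : sobolev Ω (l + 1)) (du : VecSobolev Ω (l + 2)) :
    (Fin 3 → 𝓓'(Ω, ℝ)) × VecSobolev Ω (l + 2) :=
  (fun i => (2 : ℝ) • divScaledStrain (dmu : L2 Ω) u i + (2 : ℝ) • divScaledStrain mu du i, du)

/-- The domain `H^{l+1}(Ω) × H^{l+2}(Ω)³ × H^{l+2}(Ω)³` of the two-measurement operator,
consisting of triples `(δμ, δu₁, δu₂)`. -/
abbrev Dom (Ω : Opens E3) (l : ℕ) : Type :=
  sobolev Ω (l + 1) × VecSobolev Ω (l + 2) × VecSobolev Ω (l + 2)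

/-- The target of the one-measurement operator: three interior equations (in the sense of
distributions), the interior data, and the boundary data. -/
abbrev Target (Ω : Opens E3) (l : ℕ) : Type :=
  ((Fin 3 → 𝓓'(Ω, ℝ)) × VecSobolev Ω (l + 2)) × (frontier (Ω : Set E3) → Fin 3 → ℝ)

/-- The two-measurement linearized operator
`A_μ⁽²⁾(δμ, δu₁, δu₂) = (L_μ⁽¹⁾(δμ, δu₁), B δu₁, L_μ⁽²⁾(δμ, δu₂), B δu₂)`
at the reference states `u₁`, `u₂`, in the quasi-static case. -/
def linearizedA2 {Ω : Opens E3} {l : ℕ} (mu : L2 Ω) (u₁ u₂ : VecSobolev Ω (l + 2))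
    (w : Dom Ω l) : Target Ω l × Target Ω l :=
  ((linearizedL mu u₁ w.1 w.2.1, boundaryOp w.2.1),
    (linearizedL mu u₂ w.1 w.2.2, boundaryOp w.2.2))

end

end Elastography

/-!
The operator records the fields `δu₁`, `δu₂` themselves, so the only question is whether the
coefficient is determined: if `m ∈ H^{l+1}(Ω)` satisfies `∇·(m ε(u_k)) = 0` for `k = 1, 2`, then
`m = 0` (`eq_of_divScaledStrain_eq`). It suffices to show, for one field `u` vanishing on the
boundary, that `∇·(m ε(u)) = 0` forces `m ε(u) = 0` at every point; a point where some `ε(u_k)` is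
nonsingular then has `m = 0`.

*The energy identity.* If `m` were nonnegative, testing the equation with `u` would give
`∫ m |ε(u)|² = 0`. For general `m` one tests with `sign(m) u` instead: the derivative of the sign
does not contribute, because `m` vanishes where `sign(m)` jumps. This is made precise with the
approximations `arctan (c m)` of the sign, whose derivative produces `c m / (1 + (c m)²) ∂ⱼm`, a
product of a factor that is bounded by `1` and tends to zero pointwise, and of a square-integrable
one (`IsDivFree.exists_abs_sum_integral_le`, `IsDivFree.sum_integral_abs_truncDeriv`). To have
test functions with compact support, `u` is replaced by its truncations `step (a |u|²) u`, which
vanish where `u` is small, hence near the boundary, and everything is mollified. As `a → ∞` the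
differentials of the truncations stay bounded, and one obtains `m ε(u) = 0` wherever `u ≠ 0`. At
interior points of the zero set of `u` the strain vanishes, and the remaining points are limits of
points with `u ≠ 0` (`IsDivFree.mul_eps_eq_zero`).

*Point values.* Since `2 l > 3` means `l ≥ 2`, all functions involved (`m`, `u` and `∇u`) belong
to `H³(Ω)`, and the argument needs these to be continuous up to the boundary. For a test function
`φ` and a vector `v`, integration by parts gives `φ = A φ + ∂_v (A' φ)`, where `A φ` is the mean
of `φ` over the segment from `y` to `y - v`, and `A'` is a tapered mean (`eq_avg_add_fderiv_avg`).
Pairing with `f` trades a derivative of `f` for an averaging. After three linearly independent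
directions, all averages are taken against measures of bounded density on a parallelepiped, and
the pairing is given by a continuous function (`exists_continuous_ae_eq_of_parallelepiped`). Near
a boundary point `Ω` lies above a Lipschitz graph, so a fixed steep parallelepiped based at any
point of `Ω` nearby stays inside `Ω`; this yields `exists_continuous_ae_eq_near` and
`continuousOn_pointValue`.
-/

namespace Elastography

/-! ### Test functions and weak directional derivatives -/

/-- `φ` is a smooth function with compact support contained in `Ω`; the unbundled form of
an element of `𝓓(Ω, ℝ)`. -/
structure IsTest (Ω : Opens E3) (φ : E3 → ℝ) : Prop where
  contDiff : ContDiff ℝ (⊤ : ℕ∞) φ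
  hasCompactSupport : HasCompactSupport φ
  tsupport_subset : tsupport φ ⊆ Ω

/-- The extension by zero of `f ∈ L²(Ω)` to the whole space. -/
noncomputable def zeroExt {Ω : Opens E3} (f : L2 Ω) : E3 → ℝ := (Ω : Set E3).indicator f

/-- `g` is the weak derivative of `f` on `Ω` in the direction `v`; both functions are meant to
vanish outside `Ω`. -/
def HasWeakDirDeriv (Ω : Opens E3) (v : E3) (f g : E3 → ℝ) : Prop :=
  ∀ φ : E3 → ℝ, IsTest Ω φ → ∫ x, f x * fderiv ℝ φ x v = -∫ x, g x * φ x

namespace IsTest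

variable {Ω : Opens E3} {φ : E3 → ℝ}

theorem continuous (h : IsTest Ω φ) : Continuous φ := h.contDiff.continuous

theorem differentiable (h : IsTest Ω φ) : Differentiable ℝ φ :=
  h.contDiff.differentiable (by simp)

theorem fderiv_apply (h : IsTest Ω φ) (v : E3) : IsTest Ω fun x => fderiv ℝ φ x v where
  contDiff := (h.contDiff.fderiv_right (m := (⊤ : ℕ∞)) (by simp)).clm_apply contDiff_const
  hasCompactSupport := h.hasCompactSupport.fderiv_apply ℝ v
  tsupport_subset := (tsupport_fderiv_apply_subset ℝ v).trans h.tsupport_subset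

theorem exists_bound (h : IsTest Ω φ) : ∃ C, 0 ≤ C ∧ ∀ x, |φ x| ≤ C := by
  obtain ⟨C, hC⟩ := h.hasCompactSupport.exists_bound_of_continuous h.continuous
  exact ⟨C, (norm_nonneg _).trans (hC 0), hC⟩

theorem integrable_mul {f : E3 → ℝ} (h : IsTest Ω φ) (hf : Integrable f) :
    Integrable fun x => f x * φ x := by
  obtain ⟨C, -, hC⟩ := h.exists_bound
  exact hf.mul_bdd h.continuous.aestronglyMeasurable (Filter.Eventually.of_forall hC)

end IsTest

section ZeroExt

variable {Ω : Opens E3}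

theorem zeroExt_stronglyMeasurable (f : L2 Ω) : StronglyMeasurable (zeroExt f) :=
  (Lp.stronglyMeasurable f).indicator Ω.isOpen.measurableSet

theorem zeroExt_memLp (f : L2 Ω) : MemLp (zeroExt f) 2 volume :=
  (memLp_indicator_iff_restrict Ω.isOpen.measurableSet).2 (Lp.memLp f)

theorem zeroExt_integrable (hb : Bornology.IsBounded (Ω : Set E3)) (f : L2 Ω) :
    Integrable (zeroExt f) := by
  have : IsFiniteMeasure (volume.restrict (Ω : Set E3)) :=
    ⟨by simpa using hb.measure_lt_top⟩
  exact (integrable_indicator_iff Ω.isOpen.measurableSet).2 ((Lp.memLp f).integrable (by norm_num))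

theorem integral_zeroExt_mul (f : L2 Ω) (φ : E3 → ℝ) :
    ∫ x, zeroExt f x * φ x = ∫ x in (Ω : Set E3), f x * φ x := by
  rw [← integral_indicator Ω.isOpen.measurableSet]
  congr 1
  ext x
  by_cases hx : x ∈ (Ω : Set E3) <;> simp [zeroExt, hx]

theorem zeroExt_ae_eq_iff {f g : L2 Ω} : zeroExt f =ᵐ[volume] zeroExt g ↔ f = g := by
  refine ⟨fun h => ?_, fun h => by rw [h]⟩
  refine Lp.ext ?_
  filter_upwards [ae_restrict_of_ae h, ae_restrict_mem Ω.isOpen.measurableSet] with x hx hxΩ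
  simpa [zeroExt, hxΩ] using hx

theorem zeroExt_add (f g : L2 Ω) :
    zeroExt (f + g) =ᵐ[volume] fun x => zeroExt f x + zeroExt g x := by
  filter_upwards [(ae_restrict_iff' Ω.isOpen.measurableSet).1 (Lp.coeFn_add f g)] with x hx
  by_cases hxΩ : x ∈ (Ω : Set E3)
  · simpa [zeroExt, hxΩ] using hx hxΩ
  · simp [zeroExt, hxΩ]

theorem zeroExt_smul (c : ℝ) (f : L2 Ω) :
    zeroExt (c • f) =ᵐ[volume] fun x => c * zeroExt f x := by
  filter_upwards [(ae_restrict_iff' Ω.isOpen.measurableSet).1 (Lp.coeFn_smul c f)] with x hx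
  by_cases hxΩ : x ∈ (Ω : Set E3)
  · simpa [zeroExt, hxΩ] using hx hxΩ
  · simp [zeroExt, hxΩ]

end ZeroExt

section Distribution

variable {Ω : Opens E3}

theorem toDist_mk {f : E3 → ℝ}
    (hf : LocallyIntegrableOn f (Ω : Set E3) (volume.restrict (Ω : Set E3))) {φ : E3 → ℝ}
    (h : IsTest Ω φ) :
    toDist Ω f ⟨φ, h.contDiff, h.hasCompactSupport, h.tsupport_subset⟩
      = ∫ x in (Ω : Set E3), f x * φ x := by
  rw [toDist_apply hf]
  exact integral_congr_ae (Filter.Eventually.of_forall fun x => mul_comm _ _)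

theorem distDeriv_toDist_mk {f : E3 → ℝ}
    (hf : LocallyIntegrableOn f (Ω : Set E3) (volume.restrict (Ω : Set E3))) (i : Fin 3)
    {φ : E3 → ℝ} (h : IsTest Ω φ) :
    distDeriv i (toDist Ω f) ⟨φ, h.contDiff, h.hasCompactSupport, h.tsupport_subset⟩
      = -∫ x in (Ω : Set E3), f x * fderiv ℝ φ x (basisVec i) := by
  rw [distDeriv_apply, toDist_apply hf]
  congr 1
  refine integral_congr_ae (Filter.Eventually.of_forall fun x => ?_)
  simp only
  rw [TestFunction.lineDerivCLM_apply_of_le (by simp), mul_comm]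
  congr 1
  exact (h.differentiable x).lineDeriv_eq_fderiv

theorem IsWeakDeriv.hasWeakDirDeriv {i : Fin 3} {f g : L2 Ω} (h : IsWeakDeriv i f g) :
    HasWeakDirDeriv Ω (basisVec i) (zeroExt f) (zeroExt g) := by
  intro φ hφ
  have := congrArg
    (fun T : 𝓓'(Ω, ℝ) => T ⟨φ, hφ.contDiff, hφ.hasCompactSupport, hφ.tsupport_subset⟩) h
  simp only [distDeriv_toDist_mk (locallyIntegrableOn_L2 f) i hφ,
    toDist_mk (locallyIntegrableOn_L2 g) hφ] at this
  rw [integral_zeroExt_mul, integral_zeroExt_mul, ← this, neg_neg]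

theorem HasWeakDirDeriv.add_dir (hb : Bornology.IsBounded (Ω : Set E3)) {v w : E3} {f g h : L2 Ω}
    (hv : HasWeakDirDeriv Ω v (zeroExt f) (zeroExt g))
    (hw : HasWeakDirDeriv Ω w (zeroExt f) (zeroExt h)) :
    HasWeakDirDeriv Ω (v + w) (zeroExt f) (zeroExt (g + h)) := by
  intro φ hφ
  simp only [map_add, mul_add]
  rw [integral_add ((hφ.fderiv_apply v).integrable_mul (zeroExt_integrable hb f))
    ((hφ.fderiv_apply w).integrable_mul (zeroExt_integrable hb f)), hv φ hφ, hw φ hφ,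
    ← neg_add, ← integral_add (hφ.integrable_mul (zeroExt_integrable hb g))
      (hφ.integrable_mul (zeroExt_integrable hb h))]
  congr 1
  refine integral_congr_ae ?_
  filter_upwards [zeroExt_add g h] with x hx
  rw [hx, add_mul]

theorem HasWeakDirDeriv.smul_dir {v : E3} {f g : L2 Ω} (c : ℝ)
    (hv : HasWeakDirDeriv Ω v (zeroExt f) (zeroExt g)) :
    HasWeakDirDeriv Ω (c • v) (zeroExt f) (zeroExt (c • g)) := by
  intro φ hφ
  have h1 : ∀ x, zeroExt f x * fderiv ℝ φ x (c • v) = c * (zeroExt f x * fderiv ℝ φ x v) := by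
    intro x
    rw [map_smul, smul_eq_mul]; ring
  simp only [h1]
  rw [integral_const_mul, hv φ hφ, mul_neg, ← integral_const_mul]
  congr 1
  refine integral_congr_ae ?_
  filter_upwards [zeroExt_smul c g] with x hx
  rw [hx, mul_assoc]

theorem basisVec_repr (v : E3) : v = v 0 • basisVec 0 + v 1 • basisVec 1 + v 2 • basisVec 2 := by
  ext i
  fin_cases i <;> simp [basisVec]

theorem exists_hasWeakDirDeriv (hb : Bornology.IsBounded (Ω : Set E3)) {k : ℕ} {f : L2 Ω}
    (hf : f ∈ sobolev Ω (k + 1)) (v : E3) :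
    ∃ g ∈ sobolev Ω k, HasWeakDirDeriv Ω v (zeroExt f) (zeroExt g) := by
  choose g hg h using show ∀ i : Fin 3, ∃ g ∈ sobolev Ω k, IsWeakDeriv i f g from hf
  refine ⟨v 0 • g 0 + v 1 • g 1 + v 2 • g 2, ?_, ?_⟩
  · exact add_mem (add_mem (Submodule.smul_mem _ _ (hg 0)) (Submodule.smul_mem _ _ (hg 1)))
      (Submodule.smul_mem _ _ (hg 2))
  · have := (((h 0).hasWeakDirDeriv.smul_dir (v 0)).add_dir hb
      ((h 1).hasWeakDirDeriv.smul_dir (v 1))).add_dir hb ((h 2).hasWeakDirDeriv.smul_dir (v 2))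
    rwa [← basisVec_repr v] at this

/-- Two functions agree almost everywhere on an open set if they have the same integrals
against all test functions supported there. -/
theorem ae_eq_of_integral_test_eq {U : Opens E3} {f g : E3 → ℝ}
    (hf : LocallyIntegrable f) (hg : LocallyIntegrable g)
    (h : ∀ φ, IsTest U φ → ∫ x, f x * φ x = ∫ x, g x * φ x) :
    ∀ᵐ x, x ∈ U → f x = g x := by
  have := U.isOpen.ae_eq_zero_of_integral_contDiff_smul_eq_zero (f := fun x => f x - g x)
    (μ := volume) ((hf.sub hg).locallyIntegrableOn _) ?_
  · filter_upwards [this] with x hx hxU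
    exact sub_eq_zero.1 (hx hxU)
  · intro φ h1 h2 h3
    have e : ∀ x, φ x • (f x - g x) = f x * φ x - g x * φ x := fun x => by
      simp only [smul_eq_mul]; ring
    simp only [e]
    have if' := (hf.integrable_smul_left_of_hasCompactSupport h1.continuous h2)
    have ig' := (hg.integrable_smul_left_of_hasCompactSupport h1.continuous h2)
    simp only [smul_eq_mul] at if' ig'
    rw [integral_sub (by simpa only [mul_comm] using if') (by simpa only [mul_comm] using ig'),
      h φ ⟨h1, h2, h3⟩, sub_self]

theorem HasWeakDirDeriv.unique (hb : Bornology.IsBounded (Ω : Set E3)) {v : E3} {f : E3 → ℝ}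
    {g h : L2 Ω} (hg : HasWeakDirDeriv Ω v f (zeroExt g))
    (hh : HasWeakDirDeriv Ω v f (zeroExt h)) : g = h := by
  rw [← zeroExt_ae_eq_iff]
  have := ae_eq_of_integral_test_eq (zeroExt_integrable hb g).locallyIntegrable
    (zeroExt_integrable hb h).locallyIntegrable (U := Ω) fun φ hφ => by
      rw [← neg_inj, ← hg φ hφ, hh φ hφ]
  filter_upwards [this] with x hx
  by_cases hxΩ : x ∈ Ω
  · exact hx hxΩ
  · simp [zeroExt, hxΩ]

theorem sobolev_succ_le (k : ℕ) : sobolev Ω (k + 1) ≤ sobolev Ω k := by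
  induction k with
  | zero => exact fun _ _ => Submodule.mem_top
  | succ k ih =>
    intro f hf i
    obtain ⟨g, hg, h⟩ := hf i
    exact ⟨g, ih hg, h⟩

theorem sobolev_antitone : Antitone (sobolev Ω) := antitone_nat_of_succ_le sobolev_succ_le

theorem isWeakDeriv_weakDeriv {k : ℕ} {f : L2 Ω} (hf : f ∈ sobolev Ω (k + 1)) (i : Fin 3) :
    IsWeakDeriv i f (weakDeriv i f) := by
  obtain ⟨g, -, h⟩ := hf i
  have h' : ∃ g : L2 Ω, IsWeakDeriv i f g := ⟨g, h⟩
  rw [weakDeriv, dif_pos h']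
  exact h'.choose_spec

theorem weakDeriv_mem (hb : Bornology.IsBounded (Ω : Set E3)) {k : ℕ} {f : L2 Ω}
    (hf : f ∈ sobolev Ω (k + 1)) (i : Fin 3) : weakDeriv i f ∈ sobolev Ω k := by
  obtain ⟨g, hg, h⟩ := hf i
  rwa [(isWeakDeriv_weakDeriv hf i).hasWeakDirDeriv.unique hb h.hasWeakDirDeriv]

end Distribution

/-! ### Averaging along segments -/

open Set Pointwise

section Average

/-- The average `y ↦ ∫ φ (y - z) dq(z)` of the translates of `φ` against the measure `q`. -/
noncomputable def avg (q : Measure E3) (φ : E3 → ℝ) (y : E3) : ℝ := ∫ z, φ (y - z) ∂q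

variable {φ : E3 → ℝ}

theorem avg_eq_convolution (q : Measure E3) (φ : E3 → ℝ) :
    avg q φ = convolution (fun _ => (1 : ℝ)) φ (ContinuousLinearMap.lsmul ℝ ℝ) q := by
  ext y
  simp [avg, convolution]

theorem contDiff_avg {q : Measure E3} [IsFiniteMeasure q] (h : ContDiff ℝ (⊤ : ℕ∞) φ)
    (hc : HasCompactSupport φ) :
    ContDiff ℝ (⊤ : ℕ∞) (avg q φ) := by
  rw [avg_eq_convolution]
  exact hc.contDiff_convolution_right _ (integrable_const _).locallyIntegrable h

theorem fderiv_avg_apply {q : Measure E3} [IsFiniteMeasure q] (h : ContDiff ℝ (⊤ : ℕ∞) φ)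
    (hc : HasCompactSupport φ) (y v : E3) :
    fderiv ℝ (avg q φ) y v = avg q (fun x => fderiv ℝ φ x v) y := by
  have hdc : Continuous (fderiv ℝ φ) := h.continuous_fderiv (by simp)
  obtain ⟨C, hC⟩ := (hc.fderiv ℝ).exists_bound_of_continuous hdc
  obtain ⟨C', hC'⟩ := hc.exists_bound_of_continuous h.continuous
  have hint : ∀ y, Integrable (fun z => fderiv ℝ φ (y - z)) q := fun y =>
    Integrable.of_bound (hdc.comp (continuous_const.sub continuous_id)).aestronglyMeasurable C
      (Filter.Eventually.of_forall fun z => hC _)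
  have key : HasFDerivAt (fun y => ∫ z, φ (y - z) ∂q) (∫ z, fderiv ℝ φ (y - z) ∂q) y := by
    refine hasFDerivAt_integral_of_dominated_of_fderiv_le (𝕜 := ℝ) (s := univ)
      (F' := fun y z => fderiv ℝ φ (y - z)) (bound := fun _ => C) Filter.univ_mem
      (Filter.Eventually.of_forall fun y =>
        (h.continuous.comp (continuous_const.sub continuous_id)).aestronglyMeasurable) ?_
      (hint y).aestronglyMeasurable
      (Filter.Eventually.of_forall fun z y _ => hC _) (integrable_const _)
      (Filter.Eventually.of_forall fun z y _ => ?_)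
    · exact Integrable.of_bound
        (h.continuous.comp (continuous_const.sub continuous_id)).aestronglyMeasurable C'
        (Filter.Eventually.of_forall fun z => hC' _)
    · have := (h.differentiable (by simp) (y - z)).hasFDerivAt
      exact this.comp y ((hasFDerivAt_id y).sub_const z)
  have e : fderiv ℝ (avg q φ) y = ∫ z, fderiv ℝ φ (y - z) ∂q := key.fderiv
  rw [e, ContinuousLinearMap.integral_apply (hint y)]
  rfl

theorem avg_conv {p q : Measure E3} [IsFiniteMeasure p] [IsFiniteMeasure q] (h : Continuous φ)
    (hc : HasCompactSupport φ) :
    avg (p ∗ q) φ = avg p (avg q φ) := by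
  ext y
  obtain ⟨C, hC⟩ := hc.exists_bound_of_continuous h
  simp only [avg]
  rw [integral_conv]
  · simp only [sub_sub]
  · exact Integrable.of_bound (h.comp (continuous_const.sub continuous_id)).aestronglyMeasurable C
      (Filter.Eventually.of_forall fun z => hC _)

theorem tsupport_avg_subset {q : Measure E3} {S : Set E3} (hS : IsCompact S) (hq : q Sᶜ = 0)
    (hc : HasCompactSupport φ) : tsupport (avg q φ) ⊆ tsupport φ + S := by
  refine closure_minimal ?_ (IsCompact.add hc hS).isClosed
  intro y hy
  by_contra hcon
  refine hy ?_
  refine integral_eq_zero_of_ae ?_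
  have : ∀ᵐ z ∂q, z ∈ S := hq
  filter_upwards [this] with z hz
  by_contra h0
  exact hcon ⟨y - z, subset_tsupport _ h0, z, hz, sub_add_cancel _ _⟩

theorem hasCompactSupport_avg {q : Measure E3} {S : Set E3} (hS : IsCompact S) (hq : q Sᶜ = 0)
    (hc : HasCompactSupport φ) : HasCompactSupport (avg q φ) :=
  (IsCompact.add hc hS).of_isClosed_subset isClosed_closure (tsupport_avg_subset hS hq hc)

end Average

/-- The image of Lebesgue measure on `[0, 1]` on the segment from `0` to `v`. -/
noncomputable def segMeasure (v : E3) : Measure E3 :=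
  (volume.restrict (Icc (0 : ℝ) 1)).map fun s => s • v

/-- The measure on the segment from `0` to `v` with density `1 - s` at the point `s • v`. -/
noncomputable def taperMeasure (v : E3) : Measure E3 :=
  ((volume.restrict (Icc (0 : ℝ) 1)).withDensity fun s => ENNReal.ofReal (1 - s)).map
    fun s => s • v

theorem measurable_smul_vec (v : E3) : Measurable fun s : ℝ => s • v :=
  (continuous_id.smul continuous_const).measurable

instance (v : E3) : IsFiniteMeasure (segMeasure v) := by
  unfold segMeasure; infer_instance

theorem taperMeasure_le (v : E3) : taperMeasure v ≤ segMeasure v := by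
  refine Measure.map_mono ?_ (measurable_smul_vec v)
  conv_rhs => rw [← withDensity_one (μ := volume.restrict (Icc (0 : ℝ) 1))]
  refine withDensity_mono ?_
  filter_upwards [ae_restrict_mem measurableSet_Icc] with s hs
  simpa using hs.1

instance (v : E3) : IsFiniteMeasure (taperMeasure v) :=
  isFiniteMeasure_of_le _ (taperMeasure_le v)

theorem avg_segMeasure {φ : E3 → ℝ} (h : Continuous φ) (v y : E3) :
    avg (segMeasure v) φ y = ∫ s in (0 : ℝ)..1, φ (y - s • v) := by
  rw [avg, segMeasure, integral_map (measurable_smul_vec v).aemeasurable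
    (by fun_prop : Continuous fun z => φ (y - z)).aestronglyMeasurable,
    integral_Icc_eq_integral_Ioc, intervalIntegral.integral_of_le zero_le_one]

theorem avg_taperMeasure {φ : E3 → ℝ} (h : Continuous φ) (v y : E3) :
    avg (taperMeasure v) φ y = ∫ s in (0 : ℝ)..1, (1 - s) * φ (y - s • v) := by
  rw [avg, taperMeasure, integral_map (measurable_smul_vec v).aemeasurable
    (by fun_prop : Continuous fun z => φ (y - z)).aestronglyMeasurable,
    integral_withDensity_eq_integral_toReal_smul (by fun_prop)
      (Filter.Eventually.of_forall fun _ => ENNReal.ofReal_lt_top),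
    intervalIntegral.integral_of_le zero_le_one, ← integral_Icc_eq_integral_Ioc]
  refine setIntegral_congr_fun measurableSet_Icc fun s hs => ?_
  simp only [smul_eq_mul]
  rw [ENNReal.toReal_ofReal (by linarith [hs.2])]

/-- Integration by parts along a segment: a test function is its mean over a segment in the
direction `v` plus the `v`-derivative of a tapered mean. -/
theorem eq_avg_add_fderiv_avg {φ : E3 → ℝ} (h : ContDiff ℝ (⊤ : ℕ∞) φ) (hc : HasCompactSupport φ)
    (v y : E3) :
    φ y = avg (segMeasure v) φ y + fderiv ℝ (avg (taperMeasure v) φ) y v := by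
  have hdc : Continuous fun x => fderiv ℝ φ x v :=
    (h.continuous_fderiv (by simp)).clm_apply continuous_const
  have hline : Continuous fun s : ℝ => y - s • v := by fun_prop
  rw [fderiv_avg_apply h hc, avg_segMeasure h.continuous, avg_taperMeasure hdc]
  have hd : ∀ s : ℝ, HasDerivAt (fun s : ℝ => φ (y - s • v)) (-fderiv ℝ φ (y - s • v) v) s := by
    intro s
    have h1 : HasDerivAt (fun s : ℝ => y - s • v) (-v) s := by
      simpa using ((hasDerivAt_id s).smul_const v).const_sub y
    rw [← map_neg]
    exact ((h.differentiable (by simp) (y - s • v)).hasFDerivAt).comp_hasDerivAt s h1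
  have hparts := intervalIntegral.integral_mul_deriv_eq_deriv_mul (a := 0) (b := 1)
    (u := fun s : ℝ => 1 - s) (u' := fun _ => -1) (v := fun s : ℝ => φ (y - s • v))
    (v' := fun s => -fderiv ℝ φ (y - s • v) v)
    (fun s _ => by simpa using (hasDerivAt_id s).const_sub 1) (fun s _ => hd s)
    (by simp) ((hdc.comp hline).neg.intervalIntegrable _ _)
  simp only [mul_neg, intervalIntegral.integral_neg, sub_self, zero_mul, sub_zero, one_mul,
    zero_smul, neg_mul] at hparts
  linarith

/-- The convolution of the segment measures of a list of vectors: the image of Lebesgue measure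
on a cube under `s ↦ ∑ sᵢ vᵢ`. -/
noncomputable def boxMeasure : List E3 → Measure E3
  | [] => Measure.dirac 0
  | v :: us => segMeasure v ∗ boxMeasure us

/-- The parallelepiped `{∑ sᵢ vᵢ | 0 ≤ sᵢ ≤ 1}` spanned by a list of vectors. -/
def boxSet : List E3 → Set E3
  | [] => {0}
  | v :: us => (fun s : ℝ => s • v) '' Icc 0 1 + boxSet us

instance boxMeasure_finite : ∀ us : List E3, IsFiniteMeasure (boxMeasure us)
  | [] => by unfold boxMeasure; infer_instance
  | v :: us => by
    have := boxMeasure_finite us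
    unfold boxMeasure; infer_instance

theorem isCompact_boxSet : ∀ us : List E3, IsCompact (boxSet us)
  | [] => isCompact_singleton
  | v :: us => (isCompact_Icc.image (by fun_prop)).add (isCompact_boxSet us)

theorem boxSet_subset_reverseAux (vs us : List E3) : boxSet us ⊆ boxSet (vs.reverseAux us) := by
  induction vs generalizing us with
  | nil => exact subset_rfl
  | cons v vs ih =>
    refine subset_trans (fun x hx => ?_) (ih (v :: us))
    exact ⟨0, ⟨0, by simp, by simp⟩, x, hx, by simp⟩

theorem segMeasure_compl (v : E3) : segMeasure v ((fun s : ℝ => s • v) '' Icc 0 1)ᶜ = 0 := by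
  have hS : IsCompact ((fun s : ℝ => s • v) '' Icc 0 1) := isCompact_Icc.image (by fun_prop)
  rw [segMeasure, Measure.map_apply (measurable_smul_vec v) hS.measurableSet.compl,
    Measure.restrict_apply (measurable_smul_vec v hS.measurableSet.compl)]
  convert measure_empty (μ := volume)
  ext s
  simp only [mem_inter_iff, mem_preimage, mem_compl_iff, mem_empty_iff_false, iff_false, not_and]
  exact fun h hs => h ⟨s, hs, rfl⟩

theorem boxMeasure_compl : ∀ us : List E3, boxMeasure us (boxSet us)ᶜ = 0
  | [] => by
    rw [boxMeasure, boxSet, Measure.dirac_apply' _ (measurableSet_singleton _).compl]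
    simp
  | v :: us => by
    have h1 : ∀ᵐ z ∂segMeasure v, z ∈ (fun s : ℝ => s • v) '' Icc (0 : ℝ) 1 := segMeasure_compl v
    have h2 : ∀ᵐ z ∂boxMeasure us, z ∈ boxSet us := boxMeasure_compl us
    rw [boxMeasure, Measure.conv, Measure.map_apply measurable_add
      (isCompact_boxSet (v :: us)).measurableSet.compl]
    have : ∀ᵐ z ∂(segMeasure v).prod (boxMeasure us), z.1 + z.2 ∈ boxSet (v :: us) := by
      filter_upwards [Measure.quasiMeasurePreserving_fst.ae h1,
        Measure.quasiMeasurePreserving_snd.ae h2] with z hz1 hz2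
      exact ⟨_, hz1, _, hz2, rfl⟩
    exact this

theorem conv_mono {p p' q q' : Measure E3} [SFinite q'] (hp : p ≤ p') (hq : q ≤ q') :
    p ∗ q ≤ p' ∗ q' :=
  Measure.map_mono (Measure.prod_mono hp hq) measurable_add

theorem isTest_avg {Ω : Opens E3} {us : List E3} {q : Measure E3} [IsFiniteMeasure q]
    (hq : q ≤ boxMeasure us) {φ : E3 → ℝ} (h : ContDiff ℝ (⊤ : ℕ∞) φ) (hc : HasCompactSupport φ)
    (hsub : tsupport φ + boxSet us ⊆ Ω) : IsTest Ω (avg q φ) := by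
  have h0 : q (boxSet us)ᶜ = 0 := le_antisymm ((hq _).trans (boxMeasure_compl us).le) bot_le
  exact ⟨contDiff_avg h hc, hasCompactSupport_avg (isCompact_boxSet us) h0 hc,
    (tsupport_avg_subset (isCompact_boxSet us) h0 hc).trans hsub⟩

/-- Three linearly independent segments sweep out a set of positive volume: the measure of the
parallelepiped has bounded density. -/
theorem boxMeasure_le_smul_volume {v : Fin 3 → E3} (hv : LinearIndependent ℝ v) :
    ∃ C : NNReal, boxMeasure [v 2, v 1, v 0] ≤ C • (volume : Measure E3) := by
  let T : (ℝ × ℝ × ℝ) →ₗ[ℝ] E3 :=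
    (LinearMap.fst ℝ ℝ (ℝ × ℝ)).smulRight (v 2) +
      ((LinearMap.fst ℝ ℝ ℝ ∘ₗ LinearMap.snd ℝ ℝ (ℝ × ℝ)).smulRight (v 1) +
        (LinearMap.snd ℝ ℝ ℝ ∘ₗ LinearMap.snd ℝ ℝ (ℝ × ℝ)).smulRight (v 0))
  have hT : ∀ s, T s = s.1 • v 2 + (s.2.1 • v 1 + s.2.2 • v 0) := fun s => rfl
  have hinj : Function.Injective T := by
    rw [injective_iff_map_eq_zero]
    intro s hs
    have h := Fintype.linearIndependent_iff.1 hv ![s.2.2, s.2.1, s.1] (by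
      rw [← hs, hT, Fin.sum_univ_three]
      simp only [Matrix.cons_val]
      abel)
    refine Prod.ext (h 2) (Prod.ext (h 1) (h 0))
  let e : (ℝ × ℝ × ℝ) ≃L[ℝ] E3 :=
    (LinearEquiv.ofInjectiveOfFinrankEq T hinj (by simp)).toContinuousLinearEquiv
  have he : ∀ s, e s = T s := fun s => rfl
  have hmeas : Measurable T := (e.continuous.congr he).measurable
  have hHaar : (Measure.map T volume).IsAddHaarMeasure := by
    have : Measure.map T volume = Measure.map e volume := by
      congr 1
    have h2 : (volume : Measure (ℝ × ℝ)).IsAddHaarMeasure := by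
      rw [Measure.volume_eq_prod]; infer_instance
    have h3 : (volume : Measure (ℝ × ℝ × ℝ)).IsAddHaarMeasure := by
      rw [Measure.volume_eq_prod]; infer_instance
    rw [this]
    exact e.isAddHaarMeasure_map volume
  refine ⟨(Measure.map T volume).addHaarScalarFactor volume, ?_⟩
  rw [← Measure.isAddLeftInvariant_eq_smul (Measure.map T volume) volume]
  have hbox : boxMeasure [v 2, v 1, v 0] = Measure.map T
      ((volume.restrict (Icc (0 : ℝ) 1)).prod
        ((volume.restrict (Icc (0 : ℝ) 1)).prod (volume.restrict (Icc (0 : ℝ) 1)))) := by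
    simp only [boxMeasure, Measure.conv_dirac_zero]
    simp only [segMeasure, Measure.conv]
    rw [Measure.map_prod_map _ _ (measurable_smul_vec _) (measurable_smul_vec _),
      Measure.map_map measurable_add (by fun_prop),
      Measure.map_prod_map _ _ (measurable_smul_vec _) (by fun_prop),
      Measure.map_map measurable_add (by fun_prop)]
    rfl
  rw [hbox]
  exact Measure.map_mono (Measure.prod_mono Measure.restrict_le_self
    (Measure.prod_mono Measure.restrict_le_self Measure.restrict_le_self)) hmeas

/-! ### Continuity of averages and local continuous representatives -/

/-- Averaging an integrable function against a measure of bounded density gives a continuous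
function, which represents the adjoint of `avg q`. -/
theorem exists_continuous_integral_avg {q : Measure E3} [IsFiniteMeasure q] {C : NNReal}
    (hq : q ≤ C • (volume : Measure E3)) {f : E3 → ℝ} (hfm : StronglyMeasurable f)
    (hf : Integrable f) :
    ∃ G : E3 → ℝ, Continuous G ∧ ∀ φ : E3 → ℝ, Continuous φ → HasCompactSupport φ →
      ∫ y, f y * avg q φ y = ∫ x, G x * φ x := by
  have hint : ∀ g : E3 → ℝ, Integrable g → ∀ x, Integrable (fun z => g (x + z)) q := fun g hg x =>
    ((hg.comp_add_left x).smul_measure_nnreal (c := C)).mono_measure hq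
  refine ⟨fun x => ∫ z, f (x + z) ∂q, ?_, fun φ hφ hc => ?_⟩
  · refine continuous_of_uniform_approx_of_continuous fun u hu => ?_
    obtain ⟨ε, hε, hεu⟩ := Metric.mem_uniformity_dist.1 hu
    have hC : (0 : ℝ) < C + 1 := by positivity
    obtain ⟨h, hhc, hhε, hh, hhi⟩ :=
      hf.exists_hasCompactSupport_integral_sub_le (ε := ε / 2 / (C + 1)) (by positivity)
    obtain ⟨B, hB⟩ := hhc.exists_bound_of_continuous hh
    refine ⟨fun x => ∫ z, h (x + z) ∂q, ?_, fun x => hεu ?_⟩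
    · refine continuous_of_dominated (bound := fun _ => B) (fun x => ?_)
        (fun x => Filter.Eventually.of_forall fun z => hB _) (integrable_const _)
        (Filter.Eventually.of_forall fun z => by fun_prop)
      exact (by fun_prop : Continuous fun z => h (x + z)).aestronglyMeasurable
    · rw [Real.dist_eq, ← integral_sub (hint f hf x) (hint h hhi x)]
      have hsub : Integrable (fun z => ‖f z - h z‖) := (hf.sub hhi).norm
      calc |∫ z, (f (x + z) - h (x + z)) ∂q|
          ≤ ∫ z, ‖f (x + z) - h (x + z)‖ ∂q := abs_integral_le_integral_abs
        _ ≤ ∫ z, ‖f (x + z) - h (x + z)‖ ∂(C • (volume : Measure E3)) :=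
            integral_mono_measure hq (Filter.Eventually.of_forall fun _ => norm_nonneg _)
              ((hsub.comp_add_left x).smul_measure_nnreal (c := C))
        _ = C * ∫ z, ‖f z - h z‖ := by
            rw [integral_smul_nnreal_measure,
              integral_add_left_eq_self (fun z => ‖f z - h z‖) x]
            rfl
        _ ≤ C * (ε / 2 / (C + 1)) := by gcongr
        _ ≤ (C + 1) * (ε / 2 / (C + 1)) := by gcongr; linarith
        _ = ε / 2 := by field_simp
        _ < ε := by linarith
  · obtain ⟨B, hB⟩ := hc.exists_bound_of_continuous hφ
    have hfz : Integrable (fun p : E3 × E3 => f (p.1 + p.2)) ((volume : Measure E3).prod q) := by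
      have hm : StronglyMeasurable fun p : E3 × E3 => f (p.1 + p.2) :=
        hfm.comp_measurable measurable_add
      rw [integrable_prod_iff' hm.aestronglyMeasurable]
      refine ⟨Filter.Eventually.of_forall fun z => hf.comp_add_right z, ?_⟩
      simp only [integral_add_right_eq_self (fun x => ‖f x‖)]
      exact integrable_const _
    have h1 : Integrable (Function.uncurry fun y z => f y * φ (y - z))
        ((volume : Measure E3).prod q) := by
      refine (hf.comp_fst q).mul_bdd (c := B) ?_ (Filter.Eventually.of_forall fun p => hB _)
      exact (by fun_prop : Continuous fun p : E3 × E3 => φ (p.1 - p.2)).aestronglyMeasurable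
    have h2 : Integrable (Function.uncurry fun x z => f (x + z) * φ x)
        ((volume : Measure E3).prod q) := by
      refine hfz.mul_bdd (c := B) ?_ (Filter.Eventually.of_forall fun p => hB _)
      exact (by fun_prop : Continuous fun p : E3 × E3 => φ p.1).aestronglyMeasurable
    calc ∫ y, f y * avg q φ y = ∫ y, ∫ z, f y * φ (y - z) ∂q := by
          simp only [avg, integral_const_mul]
      _ = ∫ z, (∫ y, f y * φ (y - z)) ∂q := integral_integral_swap h1
      _ = ∫ z, (∫ x, f (x + z) * φ x) ∂q := by
          congr 1
          ext z
          rw [← integral_add_right_eq_self (fun y => f y * φ (y - z)) z]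
          simp only [add_sub_cancel_right]
      _ = ∫ x, ∫ z, f (x + z) * φ x ∂q := (integral_integral_swap h2).symm
      _ = ∫ x, (∫ z, f (x + z) ∂q) * φ x := by simp only [integral_mul_const]

/-- Sobolev representation: if `f` has as many square-integrable derivatives as there are vectors
in the list `vs`, then its pairing with averaged test functions is given by a continuous
function, as soon as the total averaging measure has bounded density. Each derivative is traded
for an averaging along one more segment; `us` lists the segments already used, and `q` is a
convolution of plain or tapered measures on them. -/
theorem exists_continuous_rep_of_sobolev {Ω : Opens E3}
    (hb : Bornology.IsBounded (Ω : Set E3)) (vs : List E3) :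
    ∀ (us : List E3) (q : Measure E3) [IsFiniteMeasure q] (f : L2 Ω) (C : NNReal),
      f ∈ sobolev Ω vs.length → q ≤ boxMeasure us →
      boxMeasure (vs.reverseAux us) ≤ C • (volume : Measure E3) →
      ∃ G : E3 → ℝ, Continuous G ∧ ∀ φ : E3 → ℝ, ContDiff ℝ (⊤ : ℕ∞) φ → HasCompactSupport φ →
        tsupport φ + boxSet (vs.reverseAux us) ⊆ Ω →
        ∫ x, zeroExt f x * avg q φ x = ∫ x, G x * φ x := by
  induction vs with
  | nil =>
    intro us q _ f C _ hq hC
    obtain ⟨G, hG, h⟩ := exists_continuous_integral_avg (hq.trans hC)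
      (zeroExt_stronglyMeasurable f) (zeroExt_integrable hb f)
    exact ⟨G, hG, fun φ hφ hc _ => h φ hφ.continuous hc⟩
  | cons v vs ih =>
    intro us q _ f C hf hq hC
    obtain ⟨g, hg, hfg⟩ := exists_hasWeakDirDeriv hb hf v
    have hT : segMeasure v ∗ q ≤ boxMeasure (v :: us) := conv_mono le_rfl hq
    have hR : taperMeasure v ∗ q ≤ boxMeasure (v :: us) := conv_mono (taperMeasure_le v) hq
    obtain ⟨G₁, hG₁, h₁⟩ := ih (v :: us) (segMeasure v ∗ q) f C (sobolev_succ_le _ hf) hT hC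
    obtain ⟨G₂, hG₂, h₂⟩ := ih (v :: us) (taperMeasure v ∗ q) g C hg hR hC
    refine ⟨fun x => G₁ x - G₂ x, hG₁.sub hG₂, fun φ hφ hc hsub => ?_⟩
    have hsub' : tsupport φ + boxSet (v :: us) ⊆ Ω :=
      (add_subset_add_left (boxSet_subset_reverseAux vs (v :: us))).trans hsub
    have hsubq : tsupport φ + boxSet us ⊆ Ω :=
      (add_subset_add_left (boxSet_subset_reverseAux [v] us)).trans hsub'
    have hψ : IsTest Ω (avg q φ) := isTest_avg hq hφ hc hsubq
    have hTt : IsTest Ω (avg (segMeasure v ∗ q) φ) := isTest_avg hT hφ hc hsub'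
    have hRt : IsTest Ω (avg (taperMeasure v ∗ q) φ) := isTest_avg hR hφ hc hsub'
    have hsplit : ∀ x, zeroExt f x * avg q φ x = zeroExt f x * avg (segMeasure v ∗ q) φ x +
        zeroExt f x * fderiv ℝ (avg (taperMeasure v ∗ q) φ) x v := by
      intro x
      rw [avg_conv hφ.continuous hc, avg_conv hφ.continuous hc, ← mul_add,
        ← eq_avg_add_fderiv_avg hψ.contDiff hψ.hasCompactSupport]
    have hfi := zeroExt_integrable hb f
    simp only [hsplit, sub_mul]
    rw [integral_add (hTt.integrable_mul hfi) ((hRt.fderiv_apply v).integrable_mul hfi),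
      hfg _ hRt, h₁ φ hφ hc hsub, h₂ φ hφ hc hsub, ← sub_eq_add_neg, integral_sub]
    · exact (hG₁.mul hφ.continuous).integrable_of_hasCompactSupport hc.mul_left
    · exact (hG₂.mul hφ.continuous).integrable_of_hasCompactSupport hc.mul_left

/-- A function in `H³(Ω)` has a continuous representative near every part `Ω ∩ B` of `Ω` from which
a fixed nondegenerate parallelepiped stays inside `Ω`. -/
theorem exists_continuous_ae_eq_of_parallelepiped {Ω : Opens E3}
    (hb : Bornology.IsBounded (Ω : Set E3)) {f : L2 Ω} (hf : f ∈ sobolev Ω 3) {U : Opens E3}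
    {v : Fin 3 → E3} (hv : LinearIndependent ℝ v)
    (hU : ∀ x ∈ U, ∀ y ∈ boxSet [v 2, v 1, v 0], x + y ∈ Ω) :
    ∃ G : E3 → ℝ, Continuous G ∧ ∀ᵐ x, x ∈ U → zeroExt f x = G x := by
  obtain ⟨C, hC⟩ := boxMeasure_le_smul_volume hv
  obtain ⟨G, hG, h⟩ := exists_continuous_rep_of_sobolev hb [v 0, v 1, v 2] [] (Measure.dirac 0) f C
    hf le_rfl hC
  refine ⟨G, hG, ae_eq_of_integral_test_eq (zeroExt_integrable hb f).locallyIntegrable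
    hG.locallyIntegrable fun φ hφ => ?_⟩
  rw [← h φ hφ.contDiff hφ.hasCompactSupport ?_]
  · simp [avg]
  · rintro _ ⟨x, hx, y, hy, rfl⟩
    exact hU x (hφ.tsupport_subset hx) y hy

/-! ### Inner parallelepipeds of domains with Lipschitz boundary -/

theorem mem_boxSet_iff {a b c y : E3} : y ∈ boxSet [a, b, c] ↔
    ∃ s ∈ Icc (0 : ℝ) 1, ∃ t ∈ Icc (0 : ℝ) 1, ∃ r ∈ Icc (0 : ℝ) 1,
      y = s • a + (t • b + r • c) := by
  simp only [boxSet, mem_add, mem_image, mem_singleton_iff]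
  constructor
  · rintro ⟨_, ⟨s, hs, rfl⟩, _, ⟨_, ⟨t, ht, rfl⟩, _, ⟨_, ⟨r, hr, rfl⟩, _, rfl, rfl⟩, rfl⟩, rfl⟩
    exact ⟨s, hs, t, ht, r, hr, by simp⟩
  · rintro ⟨s, hs, t, ht, r, hr, rfl⟩
    exact ⟨_, ⟨s, hs, rfl⟩, _, ⟨_, ⟨t, ht, rfl⟩, _, ⟨_, ⟨r, hr, rfl⟩, _, rfl, rfl⟩, rfl⟩, by simp⟩

theorem norm_le_of_mem_boxSet {v : Fin 3 → E3} {y : E3} (hy : y ∈ boxSet [v 2, v 1, v 0]) :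
    ‖y‖ ≤ ‖v 0‖ + ‖v 1‖ + ‖v 2‖ := by
  obtain ⟨s, hs, t, ht, r, hr, rfl⟩ := mem_boxSet_iff.1 hy
  have key : ∀ (s : ℝ) (w : E3), s ∈ Icc (0 : ℝ) 1 → ‖s • w‖ ≤ ‖w‖ := fun s w hs => by
    rw [norm_smul, Real.norm_of_nonneg hs.1]
    exact mul_le_of_le_one_left (norm_nonneg _) hs.2
  linarith [norm_add_le (s • v 2) (t • v 1 + r • v 0), norm_add_le (t • v 1) (r • v 0),
    key s (v 2) hs, key t (v 1) ht, key r (v 0) hr]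

theorem exists_parallelepiped_of_mem {Ω : Opens E3} {x₀ : E3} (hx₀ : x₀ ∈ Ω) :
    ∃ ρ > 0, ∃ v : Fin 3 → E3, LinearIndependent ℝ v ∧
      ∀ x ∈ Ω, x ∈ Metric.ball x₀ ρ → ∀ y ∈ boxSet [v 2, v 1, v 0], x + y ∈ Ω := by
  obtain ⟨r, hr, hball⟩ := Metric.isOpen_iff.1 Ω.isOpen x₀ hx₀
  refine ⟨r / 2, by positivity, fun i => (r / 8) • basisVec i, ?_, fun x _ hx y hy => ?_⟩
  · rw [Fintype.linearIndependent_iff]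
    intro g hg i
    have := congrArg (fun z : E3 => z i) hg
    rw [Fin.sum_univ_three] at this
    have hr' : r ≠ 0 := hr.ne'
    fin_cases i <;> simpa [basisVec, hr'] using this
  · have hn := norm_le_of_mem_boxSet (v := fun i => (r / 8) • basisVec i) hy
    have h1 : ∀ i : Fin 3, ‖(r / 8) • basisVec i‖ = r / 8 := fun i => by
      rw [norm_smul, basisVec, PiLp.norm_single, Real.norm_of_nonneg (by positivity)]
      simp
    simp only [h1] at hn
    refine hball ?_
    rw [Metric.mem_ball, dist_eq_norm] at hx ⊢
    calc ‖x + y - x₀‖ = ‖(x - x₀) + y‖ := by congr 1; abel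
      _ ≤ ‖x - x₀‖ + ‖y‖ := norm_add_le _ _
      _ < r := by linarith

/-- Near a boundary point, `Ω` lies above the graph of a function that is Lipschitz on a
neighbourhood, so a small parallelepiped spanned by directions steeper than the graph can be moved
along with any point of `Ω` without leaving `Ω`. -/
theorem exists_parallelepiped_of_mem_frontier {Ω : Opens E3} {k : ℕ} (hk : 1 ≤ k)
    (hbdry : HasCkBoundary k Ω) {x₀ : E3} (hx₀ : x₀ ∈ frontier (Ω : Set E3)) :
    ∃ ρ > 0, ∃ v : Fin 3 → E3, LinearIndependent ℝ v ∧
      ∀ x ∈ Ω, x ∈ Metric.ball x₀ ρ → ∀ y ∈ boxSet [v 2, v 1, v 0], x + y ∈ Ω := by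
  obtain ⟨r, hr, L, γ, hγ, hΩ⟩ := hbdry x₀ hx₀
  obtain ⟨K, t, ht, hK⟩ := ((hγ.of_le (by exact_mod_cast hk)).contDiffAt
    (x := (L x₀).fst)).exists_lipschitzOnWith
  obtain ⟨τ, hτ, hball⟩ := Metric.mem_nhds_iff.1 ht
  -- The slope `a` is chosen so small that the three directions point above the graph.
  set a : ℝ := 1 / (K + 1) with ha
  have haK : K * a ≤ 1 := by
    rw [ha, mul_one_div, div_le_one (by positivity)]; linarith
  have ha0 : 0 < a := by positivity
  let p : Fin 3 → EuclideanSpace ℝ (Fin 2) :=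
    ![a • EuclideanSpace.single 0 1, a • EuclideanSpace.single 1 1, 0]
  let w : Fin 3 → WithLp 2 (EuclideanSpace ℝ (Fin 2) × ℝ) := fun i => WithLp.toLp 2 (p i, 1)
  set W : ℝ := ‖w 0‖ + ‖w 1‖ + ‖w 2‖ + 1 with hW
  have hW0 : 0 < W := by positivity
  set m : ℝ := min r τ with hm
  have hm0 : 0 < m := lt_min hr hτ
  set c : ℝ := m / (2 * W) with hc
  have hc0 : 0 < c := by positivity
  let v : Fin 3 → E3 := fun i => c • L.symm (w i)
  have hLv : ∀ i, L (v i) = c • w i := fun i => by simp [v]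
  have hfst : ∀ z : E3, ‖(L z).fst‖ ≤ ‖z‖ := fun z => by
    rw [← L.norm_map z]
    exact WithLp.norm_fst_le (p := 2) (α := EuclideanSpace ℝ (Fin 2)) (β := ℝ) (L z)
  refine ⟨m / 2, by positivity, v, ?_, fun x hxΩ hx y hy => ?_⟩
  · rw [Fintype.linearIndependent_iff]
    intro g hg
    rw [Fin.sum_univ_three] at hg
    have h := congrArg L hg
    simp only [map_add, map_smul, map_zero] at h
    rw [hLv, hLv, hLv] at h
    have h0 := congrArg (fun z => z.fst 0) h
    have h1 := congrArg (fun z => z.fst 1) h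
    have h2 := congrArg (fun z => z.snd) h
    simp [w, p, hc0.ne', ha0.ne'] at h0 h1 h2
    have : c * (g 0 + g 1 + g 2) = 0 := by linarith
    have h3 : g 2 = 0 := by
      rcases mul_eq_zero.1 this with h | h
      · exact absurd h hc0.ne'
      · simpa [h0, h1] using h
    intro i
    fin_cases i
    exacts [h0, h1, h3]
  · have hyn : ‖y‖ < m / 2 := by
      have := norm_le_of_mem_boxSet hy
      have hv : ∀ i, ‖v i‖ = c * ‖w i‖ := fun i => by
        rw [norm_smul, L.symm.norm_map, Real.norm_of_nonneg hc0.le]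
      rw [hv, hv, hv] at this
      have h2 : c * W = m / 2 := by rw [hc]; field_simp
      nlinarith
    have hxn : ‖x - x₀‖ < m / 2 := by rwa [Metric.mem_ball, dist_eq_norm] at hx
    have hxy : ‖x + y - x₀‖ < m := by
      calc ‖x + y - x₀‖ = ‖(x - x₀) + y‖ := by congr 1; abel
        _ ≤ ‖x - x₀‖ + ‖y‖ := norm_add_le _ _
        _ < m := by linarith
    have hmr : m ≤ r := min_le_left _ _
    have hmτ : m ≤ τ := min_le_right _ _
    have hxΩ' := (hΩ x (by rw [Metric.mem_ball, dist_eq_norm]; linarith)).1 hxΩ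
    refine (hΩ (x + y) (by rw [Metric.mem_ball, dist_eq_norm]; linarith)).2 ?_
    have hmem : ∀ z : E3, ‖z - x₀‖ < m → (L z).fst ∈ t := fun z hz => by
      refine hball ?_
      rw [Metric.mem_ball, dist_eq_norm]
      have := hfst (z - x₀)
      rw [map_sub] at this
      exact lt_of_le_of_lt this (by linarith)
    have hlip := hK.dist_le_mul _ (hmem (x + y) hxy) _ (hmem x (by linarith))
    obtain ⟨s₂, h2, s₁, h1, s₀, h0, hy'⟩ := mem_boxSet_iff.1 hy
    have hLy : L y = s₂ • c • w 2 + (s₁ • c • w 1 + s₀ • c • w 0) := by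
      rw [hy']
      simp only [map_add, map_smul, hLv]
    have hq : ‖(L y).fst‖ ≤ c * a * (s₀ + s₁) := by
      have e : (L y).fst = (s₁ * c * a) • EuclideanSpace.single 1 1 +
          (s₀ * c * a) • EuclideanSpace.single 0 1 := by
        rw [hLy]
        simp [w, p, smul_smul, mul_assoc]
      rw [e]
      refine (norm_add_le _ _).trans (le_of_eq ?_)
      rw [norm_smul, norm_smul, PiLp.norm_single, PiLp.norm_single,
        Real.norm_of_nonneg (mul_nonneg (mul_nonneg h1.1 hc0.le) ha0.le),
        Real.norm_of_nonneg (mul_nonneg (mul_nonneg h0.1 hc0.le) ha0.le)]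
      simp; ring
    have hh : (L y).snd = c * (s₂ + s₁ + s₀) := by
      rw [hLy]
      simp [w]; ring
    rw [map_add] at hlip ⊢
    rw [WithLp.add_fst] at hlip ⊢
    rw [WithLp.add_snd, hh]
    rw [dist_eq_norm, dist_eq_norm, add_sub_cancel_left] at hlip
    have h3 : γ ((L x).fst + (L y).fst) - γ (L x).fst ≤ K * (c * a * (s₀ + s₁)) :=
      (le_abs_self _).trans (hlip.trans (by gcongr))
    have h4 : K * (c * a * (s₀ + s₁)) ≤ c * (s₀ + s₁) := by
      have : 0 ≤ c * (s₀ + s₁) := mul_nonneg hc0.le (add_nonneg h0.1 h1.1)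
      nlinarith
    have h5 : 0 ≤ c * s₂ := mul_nonneg hc0.le h2.1
    nlinarith

theorem exists_parallelepiped_of_mem_closure {Ω : Opens E3} {k : ℕ} (hk : 1 ≤ k)
    (hbdry : HasCkBoundary k Ω) {x₀ : E3} (hx₀ : x₀ ∈ closure (Ω : Set E3)) :
    ∃ ρ > 0, ∃ v : Fin 3 → E3, LinearIndependent ℝ v ∧
      ∀ x ∈ Ω, x ∈ Metric.ball x₀ ρ → ∀ y ∈ boxSet [v 2, v 1, v 0], x + y ∈ Ω := by
  by_cases h : x₀ ∈ Ω
  · exact exists_parallelepiped_of_mem h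
  · refine exists_parallelepiped_of_mem_frontier hk hbdry ⟨hx₀, ?_⟩
    rwa [Ω.isOpen.interior_eq]

/-- On a bounded domain with `C¹` boundary, every function in `H³(Ω)` is continuous up to the
boundary: near each point of the closure it agrees with a continuous function. -/
theorem exists_continuous_ae_eq_near {Ω : Opens E3} (hb : Bornology.IsBounded (Ω : Set E3))
    {k : ℕ} (hk : 1 ≤ k) (hbdry : HasCkBoundary k Ω) {f : L2 Ω} (hf : f ∈ sobolev Ω 3) {x₀ : E3}
    (hx₀ : x₀ ∈ closure (Ω : Set E3)) :
    ∃ ρ > 0, ∃ G : E3 → ℝ, Continuous G ∧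
      ∀ᵐ x, x ∈ (Ω : Set E3) → x ∈ Metric.ball x₀ ρ → f x = G x := by
  obtain ⟨ρ, hρ, v, hv, hΩ⟩ := exists_parallelepiped_of_mem_closure hk hbdry hx₀
  obtain ⟨G, hG, h⟩ := exists_continuous_ae_eq_of_parallelepiped hb hf
    (U := ⟨(Ω : Set E3) ∩ Metric.ball x₀ ρ, Ω.isOpen.inter Metric.isOpen_ball⟩) hv
    fun x hx => hΩ x hx.1 hx.2
  refine ⟨ρ, hρ, G, hG, ?_⟩
  filter_upwards [h] with x hx h1 h2
  rw [← hx ⟨h1, h2⟩, zeroExt, indicator_of_mem h1]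

/-! ### Point values -/

section PointValue

variable {Ω : Opens E3}

theorem tendsto_average_of_ae_eq (hb : Bornology.IsBounded (Ω : Set E3)) {f : L2 Ω} {x : E3}
    (hx : x ∈ closure (Ω : Set E3)) {U : Set E3} (hU : U ∈ 𝓝 x) {G : E3 → ℝ}
    (hG : ContinuousAt G x) (h : ∀ᵐ y, y ∈ (Ω : Set E3) → y ∈ U → f y = G y) :
    Filter.Tendsto (fun r => ⨍ y in Metric.ball x r ∩ (Ω : Set E3), f y) (𝓝[>] (0 : ℝ))
      (𝓝 (G x)) := by
  rw [Metric.tendsto_nhds]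
  intro ε hε
  have hmem : U ∩ G ⁻¹' Metric.closedBall (G x) (ε / 2) ∈ 𝓝 x :=
    Filter.inter_mem hU (hG (Metric.closedBall_mem_nhds _ (by positivity)))
  obtain ⟨δ, hδ, hball⟩ := Metric.mem_nhds_iff.1 hmem
  filter_upwards [Ioo_mem_nhdsGT hδ] with r hr
  have hfin : volume (Metric.ball x r ∩ (Ω : Set E3)) < ⊤ :=
    (measure_mono inter_subset_left).trans_lt measure_ball_lt_top
  have hopen : IsOpen (Metric.ball x r ∩ (Ω : Set E3)) := Metric.isOpen_ball.inter Ω.isOpen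
  have hne : volume (Metric.ball x r ∩ (Ω : Set E3)) ≠ 0 := by
    refine hopen.measure_ne_zero volume ?_
    exact mem_closure_iff_nhds.1 hx _ (Metric.ball_mem_nhds x hr.1)
  have hint : IntegrableOn f (Metric.ball x r ∩ (Ω : Set E3)) := by
    have : IntegrableOn f (Ω : Set E3) :=
      (integrable_indicator_iff Ω.isOpen.measurableSet).1 (zeroExt_integrable hb f)
    exact this.mono_set inter_subset_right
  have := (convex_closedBall (G x) (ε / 2)).set_average_mem Metric.isClosed_closedBall hne
    hfin.ne (f := f) ?_ hint
  · exact lt_of_le_of_lt (Metric.mem_closedBall.1 this) (by linarith)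
  · filter_upwards [ae_restrict_of_ae h, ae_restrict_mem hopen.measurableSet] with y hy hy'
    have hyδ := hball (Metric.ball_subset_ball hr.2.le hy'.1)
    rw [hy hy'.2 hyδ.1]
    exact hyδ.2

theorem pointValue_eq_of_ae_eq (hb : Bornology.IsBounded (Ω : Set E3)) {f : L2 Ω} {x : E3}
    (hx : x ∈ closure (Ω : Set E3)) {U : Set E3} (hU : U ∈ 𝓝 x) {G : E3 → ℝ}
    (hG : ContinuousAt G x) (h : ∀ᵐ y, y ∈ (Ω : Set E3) → y ∈ U → f y = G y) :
    pointValue f x = G x :=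
  (tendsto_average_of_ae_eq hb hx hU hG h).limUnder_eq

theorem pointValue_zero (x : E3) : pointValue (0 : L2 Ω) x = 0 := by
  have h : ∀ r, ⨍ y in Metric.ball x r ∩ (Ω : Set E3), (0 : L2 Ω) y = 0 := fun r => by
    rw [average_eq, integral_eq_zero_of_ae, smul_zero]
    exact ae_restrict_of_ae_restrict_of_subset inter_subset_right (Lp.coeFn_zero ℝ 2 _)
  simp only [pointValue, h]
  exact tendsto_const_nhds.limUnder_eq

variable {k : ℕ} {f : L2 Ω}

/-- The point values of `f ∈ H³(Ω)` form a function that is continuous on the closure of `Ω`. -/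
theorem continuousOn_pointValue (hb : Bornology.IsBounded (Ω : Set E3)) (hk : 1 ≤ k)
    (hbdry : HasCkBoundary k Ω) (hf : f ∈ sobolev Ω 3) :
    ContinuousOn (pointValue f) (closure (Ω : Set E3)) := by
  intro x hx
  obtain ⟨ρ, hρ, G, hG, h⟩ := exists_continuous_ae_eq_near hb hk hbdry hf hx
  refine hG.continuousWithinAt.congr_of_eventuallyEq ?_
    (pointValue_eq_of_ae_eq hb hx (Metric.ball_mem_nhds x hρ) hG.continuousAt h)
  filter_upwards [self_mem_nhdsWithin, mem_nhdsWithin_of_mem_nhds (Metric.ball_mem_nhds x hρ)]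
    with y hy hyρ
  exact pointValue_eq_of_ae_eq hb hy (Metric.isOpen_ball.mem_nhds hyρ) hG.continuousAt h

/-- A function in `H³(Ω)` agrees almost everywhere with its point values. -/
theorem ae_eq_pointValue (hb : Bornology.IsBounded (Ω : Set E3)) (hk : 1 ≤ k)
    (hbdry : HasCkBoundary k Ω) (hf : f ∈ sobolev Ω 3) :
    ∀ᵐ x, x ∈ (Ω : Set E3) → f x = pointValue f x := by
  refine measure_null_of_locally_null _ fun x hx => ?_
  have hxΩ : x ∈ (Ω : Set E3) := by
    by_contra h0
    exact hx fun h => absurd h h0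
  obtain ⟨ρ, hρ, G, hG, h⟩ := exists_continuous_ae_eq_near hb hk hbdry hf (subset_closure hxΩ)
  refine ⟨_, inter_mem_nhdsWithin _ (Metric.ball_mem_nhds x hρ), ?_⟩
  refine measure_mono_null (fun y hy => ?_) (ae_iff.1 h)
  intro hcon
  have hyΩ : y ∈ (Ω : Set E3) := by
    by_contra h0
    exact hy.1 fun h => absurd h h0
  exact hy.1 fun _ => (hcon hyΩ hy.2).trans (pointValue_eq_of_ae_eq hb (subset_closure hyΩ)
    (Metric.isOpen_ball.mem_nhds hy.2) hG.continuousAt h).symm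

/-- The continuous representative of `f` on `Ω`, extended by zero. -/
noncomputable def pointExt (f : L2 Ω) : E3 → ℝ := (Ω : Set E3).indicator (pointValue f)

theorem pointExt_of_mem (f : L2 Ω) {x : E3} (hx : x ∈ Ω) : pointExt f x = pointValue f x :=
  indicator_of_mem hx _

theorem pointExt_of_notMem (f : L2 Ω) {x : E3} (hx : x ∉ Ω) : pointExt f x = 0 :=
  indicator_of_notMem hx _

theorem zeroExt_ae_eq_pointExt (hb : Bornology.IsBounded (Ω : Set E3)) (hk : 1 ≤ k)
    (hbdry : HasCkBoundary k Ω) (hf : f ∈ sobolev Ω 3) : zeroExt f =ᵐ[volume] pointExt f := by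
  filter_upwards [ae_eq_pointValue hb hk hbdry hf] with x hx
  by_cases h : x ∈ (Ω : Set E3)
  · rw [zeroExt, pointExt, indicator_of_mem h, indicator_of_mem h, hx h]
  · rw [zeroExt, pointExt, indicator_of_notMem h, indicator_of_notMem h]

/-- A bounded function that is continuous on `Ω` and vanishes outside. -/
structure IsBddExt (Ω : Opens E3) (f : E3 → ℝ) : Prop where
  continuousOn : ContinuousOn f Ω
  eq_zero : ∀ x ∉ Ω, f x = 0
  bounded : ∃ B, 0 ≤ B ∧ ∀ x, |f x| ≤ B

namespace IsBddExt

variable {f : E3 → ℝ}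

theorem continuousAt (h : IsBddExt Ω f) {x : E3} (hx : x ∈ Ω) : ContinuousAt f x :=
  h.continuousOn.continuousAt (Ω.isOpen.mem_nhds hx)

theorem aestronglyMeasurable (h : IsBddExt Ω f) : AEStronglyMeasurable f volume := by
  have e : (Ω : Set E3).indicator f = f :=
    indicator_eq_self.2 fun x hx => by
      by_contra h0
      exact hx (h.eq_zero x h0)
  rw [← e, aestronglyMeasurable_indicator_iff Ω.isOpen.measurableSet]
  exact h.continuousOn.aestronglyMeasurable Ω.isOpen.measurableSet

theorem integrable (h : IsBddExt Ω f) (hb : Bornology.IsBounded (Ω : Set E3)) :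
    Integrable f := by
  obtain ⟨B, -, hB⟩ := h.bounded
  have e : (Ω : Set E3).indicator f = f :=
    indicator_eq_self.2 fun x hx => by
      by_contra h0
      exact hx (h.eq_zero x h0)
  rw [← e, integrable_indicator_iff Ω.isOpen.measurableSet]
  exact IntegrableOn.of_bound hb.measure_lt_top h.aestronglyMeasurable.restrict B
    (Filter.Eventually.of_forall hB)

end IsBddExt

theorem isBddExt_pointExt (hb : Bornology.IsBounded (Ω : Set E3)) (hk : 1 ≤ k)
    (hbdry : HasCkBoundary k Ω) (hf : f ∈ sobolev Ω 3) : IsBddExt Ω (pointExt f) := by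
  have hc := continuousOn_pointValue hb hk hbdry hf
  refine ⟨?_, fun x hx => pointExt_of_notMem f hx, ?_⟩
  · exact (hc.mono subset_closure).congr fun x hx => pointExt_of_mem f hx
  · obtain ⟨B, hB⟩ := hb.isCompact_closure.exists_bound_of_continuousOn hc
    refine ⟨|B|, abs_nonneg _, fun x => ?_⟩
    by_cases h : x ∈ Ω
    · rw [pointExt_of_mem f h]
      exact (hB x (subset_closure h)).trans (le_abs_self B)
    · rw [pointExt_of_notMem f h, abs_zero]
      exact abs_nonneg _

/-- If the boundary values of `f ∈ H³(Ω)` vanish, its extension by zero is continuous. -/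
theorem continuous_pointExt (hb : Bornology.IsBounded (Ω : Set E3)) (hk : 1 ≤ k)
    (hbdry : HasCkBoundary k Ω) (hf : f ∈ sobolev Ω 3)
    (h0 : ∀ x ∈ frontier (Ω : Set E3), pointValue f x = 0) : Continuous (pointExt f) := by
  have e : pointExt f = (closure (Ω : Set E3)).indicator (pointValue f) := by
    ext x
    by_cases hx : x ∈ Ω
    · rw [pointExt_of_mem f hx, indicator_of_mem (subset_closure hx)]
    · rw [pointExt_of_notMem f hx]
      by_cases hx' : x ∈ closure (Ω : Set E3)
      · rw [indicator_of_mem hx', h0 x ⟨hx', by rwa [Ω.isOpen.interior_eq]⟩]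
      · rw [indicator_of_notMem hx']
  rw [e]
  refine continuous_indicator (fun x hx => h0 x (frontier_closure_subset hx)) ?_
  rw [closure_closure]
  exact continuousOn_pointValue hb hk hbdry hf

end PointValue

/-! ### Mollification -/

open scoped Convolution

/-- A smooth bump function at the origin supported in the ball of radius `1 / (n + 1)`. -/
noncomputable def bump (n : ℕ) : ContDiffBump (0 : E3) where
  rIn := 1 / (2 * ((n : ℝ) + 1))
  rOut := 1 / ((n : ℝ) + 1)
  rIn_pos := by positivity
  rIn_lt_rOut := by
    apply one_div_lt_one_div_of_lt <;> linarith [(Nat.cast_nonneg n : (0 : ℝ) ≤ n)]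

/-- The mollification of `f` at scale `1 / (n + 1)`. -/
noncomputable def moll (n : ℕ) (f : E3 → ℝ) (x : E3) : ℝ :=
  ∫ y, f y * (bump n).normed volume (x - y)

theorem bump_tendsto : Filter.Tendsto (fun n => (bump n).rOut) Filter.atTop (𝓝 0) :=
  tendsto_one_div_add_atTop_nhds_zero_nat

section Mollify

variable {f : E3 → ℝ} (n : ℕ)

theorem moll_eq_convolution_right (f : E3 → ℝ) :
    moll n f = f ⋆[ContinuousLinearMap.lsmul ℝ ℝ, volume] (bump n).normed volume := rfl

theorem moll_eq_convolution_left (f : E3 → ℝ) :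
    moll n f = (bump n).normed volume ⋆[ContinuousLinearMap.lsmul ℝ ℝ, volume] f := by
  ext x
  rw [convolution_eq_swap]
  exact integral_congr_ae (Filter.Eventually.of_forall fun y => mul_comm _ _)

theorem bump_sub_contDiff (x : E3) :
    ContDiff ℝ (⊤ : ℕ∞) fun y => (bump n).normed volume (x - y) :=
  (bump n).contDiff_normed.comp (contDiff_const.sub contDiff_id)

theorem bump_sub_tsupport (x : E3) :
    tsupport (fun y => (bump n).normed volume (x - y)) ⊆ Metric.closedBall x (bump n).rOut := by
  refine closure_minimal (fun y hy => ?_) Metric.isClosed_closedBall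
  have : x - y ∈ Function.support ((bump n).normed volume) := hy
  rw [(bump n).support_normed_eq, Metric.mem_ball, dist_zero_right] at this
  rw [Metric.mem_closedBall, dist_eq_norm, norm_sub_rev]
  exact this.le

theorem bump_sub_hasCompactSupport (x : E3) :
    HasCompactSupport fun y => (bump n).normed volume (x - y) :=
  (isCompact_closedBall x _).of_isClosed_subset isClosed_closure (bump_sub_tsupport n x)

theorem integral_bump_sub (x : E3) : ∫ y, (bump n).normed volume (x - y) = 1 := by
  rw [integral_sub_left_eq_self (fun y => (bump n).normed volume y) volume x,
    ContDiffBump.integral_normed]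

theorem integrable_mul_bump (hf : LocallyIntegrable f) (x : E3) :
    Integrable fun y => f y * (bump n).normed volume (x - y) :=
  hf.integrable_smul_right_of_hasCompactSupport (bump_sub_contDiff n x).continuous
    (bump_sub_hasCompactSupport n x)

theorem contDiff_moll (hf : LocallyIntegrable f) : ContDiff ℝ (⊤ : ℕ∞) (moll n f) := by
  rw [moll_eq_convolution_right]
  exact (bump n).hasCompactSupport_normed.contDiff_convolution_right _ hf
    (bump n).contDiff_normed

theorem tendsto_moll (hf : AEStronglyMeasurable f volume) {x : E3} (hx : ContinuousAt f x) :
    Filter.Tendsto (fun n => moll n f x) Filter.atTop (𝓝 (f x)) := by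
  simp only [moll_eq_convolution_left]
  exact ContDiffBump.convolution_tendsto_right (g := fun _ => f) (k := fun _ => x) bump_tendsto
    (μ := volume) (Filter.Eventually.of_forall fun _ => hf) (hx.tendsto.comp Filter.tendsto_snd)
    tendsto_const_nhds

theorem abs_moll_le {B : ℝ} (hB : ∀ x, |f x| ≤ B) (x : E3) : |moll n f x| ≤ B := by
  have hi : Integrable fun y => B * (bump n).normed volume (x - y) :=
    ((bump_sub_contDiff n x).continuous.integrable_of_hasCompactSupport
      (μ := volume) (bump_sub_hasCompactSupport n x)).const_mul B
  have := norm_integral_le_of_norm_le hi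
    (f := fun y => f y * (bump n).normed volume (x - y))
    (Filter.Eventually.of_forall fun y => by
      rw [norm_mul, Real.norm_of_nonneg ((bump n).nonneg_normed _)]
      exact mul_le_mul_of_nonneg_right (hB y) ((bump n).nonneg_normed _))
  rwa [integral_const_mul, integral_bump_sub, mul_one] at this

theorem eventually_abs_moll_sub_le (hf : UniformContinuous f) {ε : ℝ} (hε : 0 < ε) :
    ∀ᶠ n in Filter.atTop, ∀ x, |moll n f x - f x| ≤ ε := by
  obtain ⟨δ, hδ, h⟩ := Metric.uniformContinuous_iff.1 hf ε hε
  filter_upwards [bump_tendsto.eventually (gt_mem_nhds hδ)] with n hn x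
  rw [moll_eq_convolution_left]
  exact (bump n).dist_normed_convolution_le hf.continuous.aestronglyMeasurable
    fun y hy => (h (lt_trans hy hn)).le

/-- Away from the boundary, differentiation commutes with mollification. -/
theorem fderiv_moll {Ω : Opens E3} {v : E3} {g : E3 → ℝ} (h : HasWeakDirDeriv Ω v f g)
    (hf : LocallyIntegrable f) {x : E3} (hx : Metric.closedBall x (bump n).rOut ⊆ Ω) :
    fderiv ℝ (moll n f) x v = moll n g x := by
  have hd := ((bump n).hasCompactSupport_normed (μ := volume)).hasFDerivAt_convolution_right
    (μ := volume) (ContinuousLinearMap.lsmul ℝ ℝ) hf (bump n).contDiff_normed x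
  rw [moll_eq_convolution_right, hd.fderiv, convolution_precompR_apply _ hf
    ((bump n).hasCompactSupport_normed.fderiv ℝ)
    (((bump n).contDiff_normed (n := 1)).continuous_fderiv (by simp))]
  have htest : IsTest Ω fun y => (bump n).normed volume (x - y) :=
    ⟨bump_sub_contDiff n x, bump_sub_hasCompactSupport n x, (bump_sub_tsupport n x).trans hx⟩
  have := h _ htest
  have hfd : ∀ y, fderiv ℝ (fun y => (bump n).normed volume (x - y)) y v =
      -fderiv ℝ ((bump n).normed volume) (x - y) v := fun y => by
    have hb : HasFDerivAt ((bump n).normed volume)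
        (fderiv ℝ ((bump n).normed volume) (x - y)) (x - y) :=
      (((bump n).contDiff_normed (n := 1)).differentiable (by simp) _).hasFDerivAt
    have h2 : HasFDerivAt (fun y => (bump n).normed volume (x - y)) _ y :=
      hb.comp y ((hasFDerivAt_id y).const_sub x)
    rw [h2.fderiv]
    simp
  simp only [hfd, mul_neg, integral_neg, neg_inj] at this
  exact this

/-- Mollification does not increase the `L²` norm. -/
theorem integral_moll_sq_le {g : E3 → ℝ} (hg : MemLp g 2 volume) :
    Integrable (fun x => moll n g x ^ 2) ∧ ∫ x, moll n g x ^ 2 ≤ ∫ x, g x ^ 2 := by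
  have hl : LocallyIntegrable g := hg.locallyIntegrable (by norm_num)
  have hi : Integrable fun x => g x ^ 2 := hg.integrable_sq
  have hbi : Integrable ((bump n).normed volume) :=
    (bump n).integrable_normed (μ := volume)
  have hm : Integrable (moll n fun x => g x ^ 2) := by
    rw [moll_eq_convolution_right]
    exact hi.integrable_convolution _ hbi
  have hle : ∀ x, moll n g x ^ 2 ≤ moll n (fun x => g x ^ 2) x := by
    intro x
    -- The variance of `g` with respect to the mollifying probability measure is nonnegative.
    set c := moll n g x with hc
    have h0 : 0 ≤ ∫ y, (g y - c) ^ 2 * (bump n).normed volume (x - y) :=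
      integral_nonneg fun y => mul_nonneg (sq_nonneg _) ((bump n).nonneg_normed _)
    have e : ∀ y, (g y - c) ^ 2 * (bump n).normed volume (x - y) =
        g y ^ 2 * (bump n).normed volume (x - y) -
          2 * c * (g y * (bump n).normed volume (x - y)) +
          c ^ 2 * (bump n).normed volume (x - y) := fun y => by ring
    have i1 := integrable_mul_bump n hi.locallyIntegrable x
    have i2 := (integrable_mul_bump n hl x).const_mul (2 * c)
    have i3 := ((bump_sub_contDiff n x).continuous.integrable_of_hasCompactSupport
      (μ := volume) (bump_sub_hasCompactSupport n x)).const_mul (c ^ 2)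
    simp only [e] at h0
    have i12 : Integrable fun y => g y ^ 2 * (bump n).normed volume (x - y) -
        2 * c * (g y * (bump n).normed volume (x - y)) := i1.sub i2
    rw [integral_add i12 i3, integral_sub i1 i2, integral_const_mul, integral_const_mul,
      integral_bump_sub] at h0
    have h1 : ∫ y, g y * (bump n).normed volume (x - y) = c := rfl
    have h2 : ∫ y, g y ^ 2 * (bump n).normed volume (x - y) = moll n (fun x => g x ^ 2) x := rfl
    rw [h1, h2] at h0
    nlinarith
  have hsq : Integrable fun x => moll n g x ^ 2 := by
    refine hm.mono' ((contDiff_moll n hl).continuous.pow 2).aestronglyMeasurable ?_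
    refine Filter.Eventually.of_forall fun x => ?_
    rw [Real.norm_of_nonneg (sq_nonneg _)]
    exact hle x
  refine ⟨hsq, (integral_mono hsq hm hle).trans (le_of_eq ?_)⟩
  rw [moll_eq_convolution_right, integral_convolution (μ := volume) _ hi hbi,
    ContDiffBump.integral_normed]
  simp

end Mollify

theorem tendsto_pi_moll {Ω : Opens E3} {f : Fin 3 → E3 → ℝ} (hf : ∀ i, IsBddExt Ω (f i))
    {x : E3} (hx : x ∈ Ω) :
    Filter.Tendsto (fun n => fun k => moll n (f k) x) Filter.atTop (𝓝 fun k => f k x) :=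
  tendsto_pi_nhds.2 fun k => tendsto_moll (hf k).aestronglyMeasurable ((hf k).continuousAt hx)

/-! ### Truncation of vector fields near their zeros -/

/-- A smooth step: `0` on `(-∞, 1]` and `1` on `[2, ∞)`. -/
noncomputable def step (t : ℝ) : ℝ := Real.smoothTransition (t - 1)

theorem step_contDiff : ContDiff ℝ (⊤ : ℕ∞) step :=
  Real.smoothTransition.contDiff.comp (contDiff_id.sub contDiff_const)

theorem step_eq_zero {t : ℝ} (h : t ≤ 1) : step t = 0 :=
  Real.smoothTransition.zero_of_nonpos (by linarith)

theorem step_eq_one {t : ℝ} (h : 2 ≤ t) : step t = 1 :=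
  Real.smoothTransition.one_of_one_le (by linarith)

theorem abs_step_le (t : ℝ) : |step t| ≤ 1 := by
  rw [step, abs_of_nonneg (Real.smoothTransition.nonneg _)]
  exact Real.smoothTransition.le_one _

theorem hasDerivAt_step (t : ℝ) : HasDerivAt step (deriv step t) t :=
  (step_contDiff.differentiable (by simp) t).hasDerivAt

theorem continuous_deriv_step : Continuous (deriv step) :=
  step_contDiff.continuous_deriv (by simp)

theorem deriv_step_eq_zero_of_lt {t : ℝ} (h : t < 1) : deriv step t = 0 := by
  have : step =ᶠ[𝓝 t] fun _ => 0 := by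
    filter_upwards [gt_mem_nhds h] with s hs using step_eq_zero hs.le
  rw [this.deriv_eq, deriv_const]

theorem deriv_step_eq_zero_of_gt {t : ℝ} (h : 2 < t) : deriv step t = 0 := by
  have : step =ᶠ[𝓝 t] fun _ => 1 := by
    filter_upwards [lt_mem_nhds h] with s hs using step_eq_one hs.le
  rw [this.deriv_eq, deriv_const]

theorem exists_bound_mul_deriv_step : ∃ C, 0 ≤ C ∧ ∀ t, |t * deriv step t| ≤ C := by
  have hc : Continuous fun t => t * deriv step t := continuous_id.mul continuous_deriv_step
  obtain ⟨C, hC⟩ := (isCompact_Icc (a := (1 : ℝ)) (b := 2)).exists_bound_of_continuousOn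
    hc.continuousOn
  refine ⟨|C|, abs_nonneg _, fun t => ?_⟩
  by_cases h1 : t < 1
  · rw [deriv_step_eq_zero_of_lt h1, mul_zero, abs_zero]; exact abs_nonneg _
  by_cases h2 : 2 < t
  · rw [deriv_step_eq_zero_of_gt h2, mul_zero, abs_zero]; exact abs_nonneg _
  · exact (hC t ⟨not_lt.1 h1, not_lt.1 h2⟩).trans (le_abs_self _)

/-- The differential at `p`, applied to `d`, of the `i`-th component of the truncation
`p ↦ step (a |p|²) p`. -/
noncomputable def truncDeriv (a : ℝ) (p d : Fin 3 → ℝ) (i : Fin 3) : ℝ :=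
  d i * step (a * ∑ k, p k ^ 2) +
    p i * (deriv step (a * ∑ k, p k ^ 2) * (a * ∑ k, 2 * p k * d k))

theorem truncDeriv_eq_zero {a : ℝ} {p : Fin 3 → ℝ} (h : a * ∑ k, p k ^ 2 < 1) (d : Fin 3 → ℝ)
    (i : Fin 3) : truncDeriv a p d i = 0 := by
  rw [truncDeriv, step_eq_zero h.le, deriv_step_eq_zero_of_lt h]
  ring

theorem truncDeriv_eq_self {a : ℝ} {p : Fin 3 → ℝ} (h : 2 < a * ∑ k, p k ^ 2) (d : Fin 3 → ℝ)
    (i : Fin 3) : truncDeriv a p d i = d i := by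
  rw [truncDeriv, step_eq_one h.le, deriv_step_eq_zero_of_gt h]
  ring

theorem continuous_truncDeriv (a : ℝ) (i : Fin 3) :
    Continuous fun z : (Fin 3 → ℝ) × (Fin 3 → ℝ) => truncDeriv a z.1 z.2 i := by
  have h1 : Continuous step := step_contDiff.continuous
  have h2 := continuous_deriv_step
  unfold truncDeriv
  fun_prop

/-- The truncations have uniformly bounded differentials, since `t * step' t` is bounded. -/
theorem exists_abs_truncDeriv_le : ∃ C, 0 ≤ C ∧ ∀ (a : ℝ) (p d : Fin 3 → ℝ) (i : Fin 3), 0 ≤ a →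
    |truncDeriv a p d i| ≤ C * ∑ k, |d k| := by
  obtain ⟨C, hC0, hC⟩ := exists_bound_mul_deriv_step
  refine ⟨1 + 2 * C, by positivity, fun a p d i ha => ?_⟩
  set t := a * ∑ k, p k ^ 2 with ht
  have hsum : ∀ k, |d k| ≤ ∑ k, |d k| := fun k =>
    Finset.single_le_sum (f := fun k => |d k|) (fun _ _ => abs_nonneg _) (Finset.mem_univ k)
  have hp : ∀ k, |p i * (deriv step t * (a * (2 * p k * d k)))| ≤ 2 * C * |d k| := by
    intro k
    have h1 : |p i * p k| ≤ ∑ k, p k ^ 2 := by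
      have hi : ∀ k, p k ^ 2 ≤ ∑ k, p k ^ 2 := fun k =>
        Finset.single_le_sum (f := fun k => p k ^ 2) (fun _ _ => sq_nonneg _) (Finset.mem_univ k)
      rw [abs_mul]
      nlinarith [hi i, hi k, sq_nonneg (|p i| - |p k|), sq_abs (p i), sq_abs (p k)]
    have h2 : |deriv step t| * (a * |p i * p k|) ≤ C := by
      refine le_trans ?_ (hC t)
      rw [abs_mul t, mul_comm |t|]
      refine mul_le_mul_of_nonneg_left ?_ (abs_nonneg _)
      exact (mul_le_mul_of_nonneg_left h1 ha).trans (le_abs_self _)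
    calc |p i * (deriv step t * (a * (2 * p k * d k)))|
        = 2 * (|deriv step t| * (a * |p i * p k|)) * |d k| := by
          simp only [abs_mul, abs_of_nonneg ha, abs_two]; ring
      _ ≤ 2 * C * |d k| := by gcongr
  have hstep : |d i * step t| ≤ ∑ k, |d k| := by
    rw [abs_mul]
    exact (mul_le_of_le_one_right (abs_nonneg _) (abs_step_le t)).trans (hsum i)
  calc |truncDeriv a p d i|
      ≤ |d i * step t| + |p i * (deriv step t * (a * ∑ k, 2 * p k * d k))| := abs_add_le _ _
    _ = |d i * step t| + |∑ k, p i * (deriv step t * (a * (2 * p k * d k)))| := by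
        simp only [Finset.mul_sum]
    _ ≤ ∑ k, |d k| + ∑ k, 2 * C * |d k| := by
        refine add_le_add hstep ((Finset.abs_sum_le_sum_abs _ _).trans ?_)
        exact Finset.sum_le_sum fun k _ => hp k
    _ = (1 + 2 * C) * ∑ k, |d k| := by rw [← Finset.mul_sum]; ring

/-- The test field: the truncation of the vector field `u`, multiplied by the smooth
approximation `arctan (c m)` to the sign of `m`. -/
noncomputable def testField (a c : ℝ) (m : E3 → ℝ) (u : Fin 3 → E3 → ℝ) (i : Fin 3) (x : E3) : ℝ :=
  Real.arctan (c * m x) * (u i x * step (a * ∑ k, u k x ^ 2))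

theorem contDiff_testField {a c : ℝ} {m : E3 → ℝ} {u : Fin 3 → E3 → ℝ}
    (hm : ContDiff ℝ (⊤ : ℕ∞) m) (hu : ∀ k, ContDiff ℝ (⊤ : ℕ∞) (u k)) (i : Fin 3) :
    ContDiff ℝ (⊤ : ℕ∞) (testField a c m u i) := by
  refine ContDiff.mul ?_ ((hu i).mul ?_)
  · exact Real.contDiff_arctan.comp (contDiff_const.mul hm)
  · exact step_contDiff.comp (contDiff_const.mul (ContDiff.sum fun k _ => (hu k).pow 2))

theorem fderiv_testField {a c : ℝ} {m : E3 → ℝ} {u : Fin 3 → E3 → ℝ}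
    (hm : ContDiff ℝ (⊤ : ℕ∞) m) (hu : ∀ k, ContDiff ℝ (⊤ : ℕ∞) (u k)) (i : Fin 3) (x v : E3) :
    fderiv ℝ (testField a c m u i) x v =
      c * fderiv ℝ m x v / (1 + (c * m x) ^ 2) * (u i x * step (a * ∑ k, u k x ^ 2)) +
      Real.arctan (c * m x) *
        truncDeriv a (fun k => u k x) (fun k => fderiv ℝ (u k) x v) i := by
  have line : ∀ {f : E3 → ℝ}, ContDiff ℝ (⊤ : ℕ∞) f →
      HasDerivAt (fun t : ℝ => f (x + t • v)) (fderiv ℝ f x v) 0 := fun hf =>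
    ((hf.differentiable (by simp) x).hasFDerivAt).hasLineDerivAt v
  have h1 := ((line hm).const_mul c).arctan
  have h2 : HasDerivAt (fun t : ℝ => a * ∑ k, u k (x + t • v) ^ 2)
      (a * ∑ k, 2 * u k x * fderiv ℝ (u k) x v) 0 := by
    refine HasDerivAt.const_mul a (HasDerivAt.fun_sum fun k _ => ?_)
    simpa using (line (hu k)).fun_pow 2
  have h3 := (hasDerivAt_step (a * ∑ k, u k (x + (0 : ℝ) • v) ^ 2)).comp (0 : ℝ) h2
  have h4 := h1.mul ((line (hu i)).mul h3)
  refine ((line (contDiff_testField hm hu i)).unique h4).trans ?_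
  simp only [truncDeriv, zero_smul, add_zero, Function.comp, Pi.mul_apply]
  ring

theorem abs_arctan_le_two (t : ℝ) : |Real.arctan t| ≤ 2 := by
  rw [abs_le]
  constructor <;>
  linarith [Real.arctan_lt_pi_div_two t, Real.neg_pi_div_two_lt_arctan t, Real.pi_le_four]

theorem tendsto_arctan_mul_nat (t : ℝ) :
    Filter.Tendsto (fun n : ℕ => Real.arctan ((n : ℝ) * t)) Filter.atTop
      (𝓝 (Real.pi / 2 * Real.sign t)) := by
  rcases lt_trichotomy t 0 with ht | ht | ht
  · rw [Real.sign_of_neg ht, mul_neg_one]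
    exact ((Real.tendsto_arctan_atBot.mono_right nhdsWithin_le_nhds)).comp
      (tendsto_natCast_atTop_atTop.atTop_mul_const_of_neg ht)
  · simp [ht]
  · rw [Real.sign_of_pos ht, mul_one]
    exact ((Real.tendsto_arctan_atTop.mono_right nhdsWithin_le_nhds)).comp
      (tendsto_natCast_atTop_atTop.atTop_mul_const ht)

theorem mul_sign_eq_abs (t : ℝ) : t * Real.sign t = |t| := by
  rcases lt_trichotomy t 0 with ht | ht | ht
  · rw [Real.sign_of_neg ht, abs_of_neg ht, mul_neg_one]
  · simp [ht]
  · rw [Real.sign_of_pos ht, abs_of_pos ht, mul_one]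

/-! ### Uniqueness for the divergence equation -/

/-- The data of a solution `m` of `∇·(m ε(u)) = 0` with `u` vanishing on the boundary: `m`, `u` and
the gradient `du i j = ∂ⱼ uᵢ` are bounded and continuous in `Ω`, `u` is continuous up to the
boundary, where it vanishes, and `dm` is the square-integrable weak gradient of `m`. All functions
are extended by zero. -/
structure IsDivFree (Ω : Opens E3) (m : E3 → ℝ) (dm : Fin 3 → E3 → ℝ) (u : Fin 3 → E3 → ℝ)
    (du : Fin 3 → Fin 3 → E3 → ℝ) : Prop where
  isBounded : Bornology.IsBounded (Ω : Set E3)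
  bddExt_m : IsBddExt Ω m
  memLp_dm : ∀ j, MemLp (dm j) 2 volume
  deriv_m : ∀ j, HasWeakDirDeriv Ω (basisVec j) m (dm j)
  bddExt_u : ∀ i, IsBddExt Ω (u i)
  continuous_u : ∀ i, Continuous (u i)
  bddExt_du : ∀ i j, IsBddExt Ω (du i j)
  deriv_u : ∀ i j, HasWeakDirDeriv Ω (basisVec j) (u i) (du i j)
  eqn : ∀ i φ, IsTest Ω φ →
    ∑ j, ∫ x, m x * ((du i j x + du j i x) / 2) * fderiv ℝ φ x (basisVec j) = 0

namespace IsDivFree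

variable {Ω : Opens E3} {m : E3 → ℝ} {dm : Fin 3 → E3 → ℝ} {u : Fin 3 → E3 → ℝ}
  {du : Fin 3 → Fin 3 → E3 → ℝ}

theorem exists_common_bound (h : IsDivFree Ω m dm u du) : ∃ B, 1 ≤ B ∧ (∀ x, |m x| ≤ B) ∧
    (∀ i x, |u i x| ≤ B) ∧ ∀ i j x, |du i j x| ≤ B := by
  obtain ⟨B₁, h1, hB₁⟩ := h.bddExt_m.bounded
  choose B₂ h2 hB₂ using fun i => (h.bddExt_u i).bounded
  choose B₃ h3 hB₃ using fun i j => (h.bddExt_du i j).bounded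
  have hs2 : 0 ≤ ∑ i, B₂ i := Finset.sum_nonneg fun i _ => h2 i
  have hs3' : ∀ i, 0 ≤ ∑ j, B₃ i j := fun i => Finset.sum_nonneg fun j _ => h3 i j
  have hs3 : 0 ≤ ∑ i, ∑ j, B₃ i j := Finset.sum_nonneg fun i _ => hs3' i
  refine ⟨1 + B₁ + ∑ i, B₂ i + ∑ i, ∑ j, B₃ i j, by linarith, fun x => ?_, fun i x => ?_,
    fun i j x => ?_⟩
  · linarith [hB₁ x]
  · linarith [hB₂ i x, Finset.single_le_sum (fun i _ => h2 i) (Finset.mem_univ i)]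
  · linarith [hB₃ i j x, Finset.single_le_sum (fun j _ => h3 i j) (Finset.mem_univ j),
      Finset.single_le_sum (fun i _ => hs3' i) (Finset.mem_univ i)]

/-- The entries `(∂ⱼ uᵢ + ∂ᵢ uⱼ) / 2` of the strain tensor of the field with gradient `du`. -/
noncomputable def eps (du : Fin 3 → Fin 3 → E3 → ℝ) (i j : Fin 3) (x : E3) : ℝ :=
  (du i j x + du j i x) / 2

theorem uniformContinuous_u (h : IsDivFree Ω m dm u du) (i : Fin 3) :
    UniformContinuous (u i) := by
  refine HasCompactSupport.uniformContinuous_of_continuous ?_ (h.continuous_u i)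
  exact HasCompactSupport.intro h.isBounded.isCompact_closure fun x hx =>
    (h.bddExt_u i).eq_zero x fun hx' => hx (subset_closure hx')

/-- For fine mollification, the truncated field is supported in a compact subset of `Ω`, and its
derivatives involve the mollified weak derivatives only. -/
theorem eventually_isTest (h : IsDivFree Ω m dm u du) {a : ℝ} (ha : 0 < a) (c : ℝ) :
    ∀ᶠ n in Filter.atTop, ∀ i,
      IsTest Ω (testField a c (moll n m) (fun k => moll n (u k)) i) ∧
      ∀ j x, fderiv ℝ (testField a c (moll n m) (fun k => moll n (u k)) i) x (basisVec j) =
        c * moll n (dm j) x / (1 + (c * moll n m x) ^ 2) *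
            (moll n (u i) x * step (a * ∑ k, moll n (u k) x ^ 2)) +
          Real.arctan (c * moll n m x) *
            truncDeriv a (fun k => moll n (u k) x) (fun k => moll n (du k j) x) i := by
  obtain ⟨B, hB1, -, hBu, -⟩ := h.exists_common_bound
  have hB0 : 0 < B := by linarith
  set K : Set E3 := {x | 1 / 2 ≤ a * ∑ k, u k x ^ 2} with hK
  have hKΩ : K ⊆ Ω := by
    intro x hx
    by_contra h0
    have : ∀ k, u k x = 0 := fun k => (h.bddExt_u k).eq_zero x h0
    simp only [hK, mem_ofPred_eq, this] at hx
    norm_num at hx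
  have hcont : Continuous fun x => a * ∑ k, u k x ^ 2 :=
    continuous_const.mul (continuous_finsetSum _ fun k _ => (h.continuous_u k).pow 2)
  have hKcomp : IsCompact K :=
    h.isBounded.isCompact_closure.of_isClosed_subset (isClosed_le continuous_const hcont)
      (hKΩ.trans subset_closure)
  obtain ⟨δ, hδ, hδΩ⟩ := hKcomp.exists_cthickening_subset_open Ω.isOpen hKΩ
  have hlu : ∀ k, LocallyIntegrable (u k) := fun k => (h.continuous_u k).locallyIntegrable
  have hlm : LocallyIntegrable m := (h.bddExt_m.integrable h.isBounded).locallyIntegrable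
  -- With this accuracy `a |u|²` changes by at most `a * 3 * (2 * B) * e = 1 / 2`.
  set e : ℝ := 1 / (12 * a * B) with he
  have he0 : 0 < e := by positivity
  have hunif : ∀ᶠ n in Filter.atTop, ∀ k x, |moll n (u k) x - u k x| ≤ e :=
    Filter.eventually_all.2 fun k => eventually_abs_moll_sub_le (h.uniformContinuous_u k) he0
  filter_upwards [hunif, bump_tendsto.eventually (gt_mem_nhds hδ)] with n hn hnδ i
  -- Outside `K` the mollified field is still shorter than the truncation threshold.
  have hsmall : ∀ x, x ∉ K → a * ∑ k, moll n (u k) x ^ 2 < 1 := by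
    intro x hx
    have hx' : a * ∑ k, u k x ^ 2 < 1 / 2 := not_le.1 hx
    have hk : ∀ k, moll n (u k) x ^ 2 ≤ u k x ^ 2 + 2 * B * e := by
      intro k
      have h1 := hn k x
      have h2 : |moll n (u k) x + u k x| ≤ 2 * B :=
        (abs_add_le _ _).trans (by linarith [abs_moll_le n (hBu k) x, hBu k x])
      have h3 : (moll n (u k) x - u k x) * (moll n (u k) x + u k x) ≤ e * (2 * B) := by
        refine (le_abs_self _).trans ?_
        rw [abs_mul]
        exact mul_le_mul h1 h2 (abs_nonneg _) he0.le
      nlinarith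
    have hs : ∑ k, moll n (u k) x ^ 2 ≤ ∑ k, u k x ^ 2 + 3 * (2 * B * e) := by
      refine (Finset.sum_le_sum fun k _ => hk k).trans (le_of_eq ?_)
      rw [Finset.sum_add_distrib]
      simp
    have hae : a * (3 * (2 * B * e)) = 1 / 2 := by rw [he]; field_simp; norm_num
    nlinarith [mul_le_mul_of_nonneg_left hs ha.le]
  have hball : ∀ x ∈ K, Metric.closedBall x (bump n).rOut ⊆ Ω := fun x hx =>
    ((Metric.closedBall_subset_closedBall hnδ.le).trans
      (Metric.closedBall_subset_cthickening hx δ)).trans hδΩ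
  have hmsm := contDiff_moll n hlm
  have husm : ∀ k, ContDiff ℝ (⊤ : ℕ∞) (moll n (u k)) := fun k => contDiff_moll n (hlu k)
  have hts : tsupport (testField a c (moll n m) (fun k => moll n (u k)) i) ⊆ K := by
    refine closure_minimal (fun x hx => ?_) hKcomp.isClosed
    by_contra h0
    refine hx ?_
    rw [testField, step_eq_zero (hsmall x h0).le, mul_zero, mul_zero]
  refine ⟨⟨contDiff_testField hmsm husm i, hKcomp.of_isClosed_subset isClosed_closure hts,
    hts.trans hKΩ⟩, fun j x => ?_⟩
  rw [fderiv_testField hmsm husm]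
  by_cases hx : x ∈ K
  · simp only [fderiv_moll n (h.deriv_m j) hlm (hball x hx),
      fun k => fderiv_moll n (h.deriv_u k j) (hlu k) (hball x hx)]
  · rw [step_eq_zero (hsmall x hx).le, truncDeriv_eq_zero (hsmall x hx),
      truncDeriv_eq_zero (hsmall x hx)]
    simp

theorem integrable_mul_eps (h : IsDivFree Ω m dm u du) (i j : Fin 3) :
    Integrable fun x => m x * eps du i j x := by
  obtain ⟨B, -, -, -, hB⟩ := h.exists_common_bound
  refine (h.bddExt_m.integrable h.isBounded).mul_bdd (c := B) ?_
    (Filter.Eventually.of_forall fun x => ?_)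
  · exact (((h.bddExt_du i j).aestronglyMeasurable.add
      (h.bddExt_du j i).aestronglyMeasurable).mul_const (2⁻¹ : ℝ)).congr
      (Filter.Eventually.of_forall fun x => (div_eq_mul_inv _ _).symm)
  · rw [Real.norm_eq_abs, eps, abs_div, abs_two]
    linarith [abs_add_le (du i j x) (du j i x), hB i j x, hB j i x]

/-- The error made by replacing `m` by `m * arctan (c m)` in the equation is controlled by the
`L²` norm of `c m / (1 + (c m)²)` alone: it comes from differentiating the factor `arctan (c m)`,
and the weak gradient of `m` is square-integrable. The bound is split by Young's inequality with
parameter `τ`. -/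
theorem exists_abs_sum_integral_le (h : IsDivFree Ω m dm u du) :
    ∃ W E : ℝ, ∀ a c τ : ℝ, 0 < a → 0 < τ →
      |∑ i, ∑ j, ∫ x, m x * eps du i j x * (Real.arctan (c * m x) *
        truncDeriv a (fun k => u k x) (fun k => du k j x) i)| ≤
      W * ((∫ x, (m x * (c / (1 + (c * m x) ^ 2))) ^ 2) / τ) + E * τ := by
  obtain ⟨B, hB1, hBm, hBu, hBd⟩ := h.exists_common_bound
  have hB0 : 0 ≤ B := by linarith
  obtain ⟨C, hC0, hC⟩ := exists_abs_truncDeriv_le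
  have hmi := h.bddExt_m.integrable h.isBounded
  have hmm := h.bddExt_m.aestronglyMeasurable
  have hlu : ∀ k, LocallyIntegrable (u k) := fun k => (h.continuous_u k).locallyIntegrable
  have hld : ∀ k j, LocallyIntegrable (du k j) := fun k j =>
    ((h.bddExt_du k j).integrable h.isBounded).locallyIntegrable
  have hBe : ∀ i j x, |eps du i j x| ≤ B := fun i j x => by
    rw [eps, abs_div, abs_two]
    linarith [abs_add_le (du i j x) (du j i x), hBd i j x, hBd j i x]
  refine ⟨∑ _i : Fin 3, ∑ _j : Fin 3, B ^ 2, ∑ _i : Fin 3, ∑ j, B ^ 2 * ∫ x, dm j x ^ 2,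
    fun a c τ ha hτ => ?_⟩
  set A : ℕ → Fin 3 → Fin 3 → E3 → ℝ := fun n i j x => m x * eps du i j x *
    (c * moll n (dm j) x / (1 + (c * moll n m x) ^ 2) *
      (moll n (u i) x * step (a * ∑ k, moll n (u k) x ^ 2))) with hA
  set D : ℕ → Fin 3 → Fin 3 → E3 → ℝ := fun n i j x => m x * eps du i j x *
    (Real.arctan (c * moll n m x) *
      truncDeriv a (fun k => moll n (u k) x) (fun k => moll n (du k j) x) i) with hD
  set X : ℕ → E3 → ℝ := fun n x => m x * (c / (1 + (c * moll n m x) ^ 2)) with hX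
  have hcm : ∀ n, Continuous (moll n m) := fun n =>
    (contDiff_moll n hmi.locallyIntegrable).continuous
  have hcu : ∀ n k, Continuous (moll n (u k)) := fun n k => (contDiff_moll n (hlu k)).continuous
  have hcd : ∀ n k j, Continuous (moll n (du k j)) := fun n k j =>
    (contDiff_moll n (hld k j)).continuous
  have hcg : ∀ n j, Continuous (moll n (dm j)) := fun n j =>
    (contDiff_moll n ((h.memLp_dm j).locallyIntegrable (by norm_num))).continuous
  have hpos : ∀ t : ℝ, (0 : ℝ) < 1 + t ^ 2 := fun t => by positivity
  have hfrac : ∀ n, Continuous fun x => c / (1 + (c * moll n m x) ^ 2) := fun n =>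
    continuous_const.div (by have := hcm n; fun_prop) fun x => (hpos _).ne'
  have hfrac_le : ∀ t : ℝ, |c / (1 + t ^ 2)| ≤ |c| := fun t => by
    rw [abs_div, abs_of_pos (hpos t)]
    exact div_le_self (abs_nonneg _) (by nlinarith [sq_nonneg t])
  -- The terms in which the truncated field is differentiated.
  have hDbound : ∀ n i j x, |Real.arctan (c * moll n m x) *
      truncDeriv a (fun k => moll n (u k) x) (fun k => moll n (du k j) x) i| ≤
      2 * (C * ∑ _k : Fin 3, B) := by
    intro n i j x
    rw [abs_mul]
    refine mul_le_mul (abs_arctan_le_two _) ((hC a _ _ i ha.le).trans ?_) (abs_nonneg _) (by simp)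
    exact mul_le_mul_of_nonneg_left
      (Finset.sum_le_sum fun k _ => abs_moll_le n (hBd k j) x) hC0
  have hDcont : ∀ n i j, Continuous fun x => Real.arctan (c * moll n m x) *
      truncDeriv a (fun k => moll n (u k) x) (fun k => moll n (du k j) x) i := by
    intro n i j
    have h1 := hcm n
    refine (Real.continuous_arctan.comp (continuous_const.mul h1)).mul ?_
    exact (continuous_truncDeriv a i).comp
      ((continuous_pi fun k => hcu n k).prodMk (continuous_pi fun k => hcd n k j))
  have hDint : ∀ n i j, Integrable (D n i j) := fun n i j =>
    (h.integrable_mul_eps i j).mul_bdd (hDcont n i j).aestronglyMeasurable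
      (Filter.Eventually.of_forall (hDbound n i j))
  have hDlim : ∀ i j, Filter.Tendsto (fun n => ∫ x, D n i j x) Filter.atTop
      (𝓝 (∫ x, m x * eps du i j x * (Real.arctan (c * m x) *
        truncDeriv a (fun k => u k x) (fun k => du k j x) i))) := by
    intro i j
    refine tendsto_integral_of_dominated_convergence
      (fun x => |m x * eps du i j x| * (2 * (C * ∑ _k : Fin 3, B)))
      (fun n => (hDint n i j).aestronglyMeasurable)
      ((h.integrable_mul_eps i j).abs.mul_const _)
      (fun n => Filter.Eventually.of_forall fun x => ?_)
      (Filter.Eventually.of_forall fun x => ?_)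
    · rw [Real.norm_eq_abs, hD, abs_mul]
      exact mul_le_mul_of_nonneg_left (hDbound n i j x) (abs_nonneg _)
    · by_cases hx : x ∈ Ω
      · have t1 := tendsto_moll hmm (h.bddExt_m.continuousAt hx)
        have t2 := tendsto_pi_moll h.bddExt_u hx
        have t3 := tendsto_pi_moll (fun k => h.bddExt_du k j) hx
        refine Filter.Tendsto.const_mul _ (Filter.Tendsto.mul ?_ ?_)
        · exact (Real.continuous_arctan.tendsto _).comp (t1.const_mul c)
        · exact ((continuous_truncDeriv a i).tendsto _).comp (t2.prodMk_nhds t3)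
      · simp only [hD, h.bddExt_m.eq_zero x hx, zero_mul]
        exact tendsto_const_nhds
  -- The factor controlling the terms in which `arctan` is differentiated.
  have hXbound : ∀ n x, X n x ^ 2 ≤ c ^ 2 * B * |m x| := by
    intro n x
    have h1 : |X n x| ≤ |m x| * |c| := by
      rw [hX, abs_mul]
      exact mul_le_mul_of_nonneg_left (hfrac_le _) (abs_nonneg _)
    calc X n x ^ 2 = |X n x| ^ 2 := (sq_abs _).symm
      _ ≤ (|m x| * |c|) ^ 2 := by gcongr
      _ = c ^ 2 * |m x| * |m x| := by rw [mul_pow, sq_abs c]; ring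
      _ ≤ c ^ 2 * B * |m x| := by gcongr; exact hBm x
  have hXm : ∀ n, AEStronglyMeasurable (fun x => X n x ^ 2) volume := fun n =>
    (hmm.mul (hfrac n).aestronglyMeasurable).pow 2
  have hXint : ∀ n, Integrable fun x => X n x ^ 2 := fun n =>
    (hmi.abs.const_mul (c ^ 2 * B)).mono' (hXm n) (Filter.Eventually.of_forall fun x => by
      rw [Real.norm_of_nonneg (sq_nonneg _)]; exact hXbound n x)
  have hXlim : Filter.Tendsto (fun n => ∫ x, X n x ^ 2) Filter.atTop
      (𝓝 (∫ x, (m x * (c / (1 + (c * m x) ^ 2))) ^ 2)) := by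
    refine tendsto_integral_of_dominated_convergence (fun x => c ^ 2 * B * |m x|) hXm
      (hmi.abs.const_mul _) (fun n => Filter.Eventually.of_forall fun x => ?_)
      (Filter.Eventually.of_forall fun x => ?_)
    · rw [Real.norm_of_nonneg (sq_nonneg _)]; exact hXbound n x
    · by_cases hx : x ∈ Ω
      · have t1 := tendsto_moll hmm (h.bddExt_m.continuousAt hx)
        refine Filter.Tendsto.pow (Filter.Tendsto.const_mul _ ?_) 2
        exact tendsto_const_nhds.div (((t1.const_mul c).pow 2).const_add 1) (hpos _).ne'
      · simp only [hX, h.bddExt_m.eq_zero x hx, zero_mul]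
        exact tendsto_const_nhds
  have hAbound : ∀ n i j x,
      ‖A n i j x‖ ≤ B ^ 2 * (X n x ^ 2 / τ + moll n (dm j) x ^ 2 * τ) := by
    intro n i j x
    have h1 : A n i j x = X n x * moll n (dm j) x * (eps du i j x *
        (moll n (u i) x * step (a * ∑ k, moll n (u k) x ^ 2))) := by
      simp only [hA, hX]; ring
    have h2 : |eps du i j x * (moll n (u i) x * step (a * ∑ k, moll n (u k) x ^ 2))| ≤ B ^ 2 := by
      rw [abs_mul, abs_mul, sq]
      refine mul_le_mul (hBe i j x) ?_ (by positivity) hB0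
      exact (mul_le_of_le_one_right (abs_nonneg _) (abs_step_le _)).trans (abs_moll_le n (hBu i) x)
    have h3 : |X n x * moll n (dm j) x| ≤ X n x ^ 2 / τ + moll n (dm j) x ^ 2 * τ := by
      have key : ∀ p q : ℝ, p * q ≤ p ^ 2 + q ^ 2 := fun p q => by
        nlinarith [sq_nonneg (p - q), sq_nonneg p, sq_nonneg q]
      have h4 := key |X n x| (|moll n (dm j) x| * τ)
      rw [mul_pow, sq_abs, sq_abs] at h4
      rw [div_add' _ _ _ hτ.ne', le_div_iff₀ hτ, abs_mul]
      linarith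
    rw [h1, Real.norm_eq_abs, abs_mul, mul_comm]
    exact mul_le_mul h2 h3 (abs_nonneg _) (by positivity)
  have hsq : ∀ n j, Integrable (fun x => moll n (dm j) x ^ 2) ∧
      ∫ x, moll n (dm j) x ^ 2 ≤ ∫ x, dm j x ^ 2 := fun n j =>
    integral_moll_sq_le n (h.memLp_dm j)
  have hdom : ∀ n j, Integrable fun x =>
      B ^ 2 * (X n x ^ 2 / τ + moll n (dm j) x ^ 2 * τ) := fun n j =>
    (((hXint n).div_const τ).add ((hsq n j).1.mul_const τ)).const_mul _
  have hAint : ∀ n i j, Integrable (A n i j) := by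
    intro n i j
    refine (hdom n j).mono' ((h.integrable_mul_eps i j).aestronglyMeasurable.mul ?_)
      (Filter.Eventually.of_forall (hAbound n i j))
    have h1 := hcm n
    have h2 := hcg n j
    have h3 := hcu n
    have h4 : Continuous step := step_contDiff.continuous
    refine Continuous.aestronglyMeasurable (Continuous.mul ?_ (by fun_prop))
    exact (continuous_const.mul h2).div (by fun_prop) fun x => (hpos _).ne'
  have hAle : ∀ n i j, |∫ x, A n i j x| ≤
      B ^ 2 * ((∫ x, X n x ^ 2) / τ) + B ^ 2 * (∫ x, dm j x ^ 2) * τ := by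
    intro n i j
    refine (norm_integral_le_of_norm_le (hdom n j)
      (Filter.Eventually.of_forall (hAbound n i j))).trans ?_
    rw [integral_const_mul, integral_add ((hXint n).div_const τ) ((hsq n j).1.mul_const τ),
      integral_div, integral_mul_const, mul_add, mul_assoc]
    exact add_le_add le_rfl (mul_le_mul_of_nonneg_left
      (mul_le_mul_of_nonneg_right (hsq n j).2 hτ.le) (sq_nonneg _))
  have hev : ∀ᶠ n in Filter.atTop, |∑ i, ∑ j, ∫ x, D n i j x| ≤
      ∑ _i : Fin 3, ∑ j, (B ^ 2 * ((∫ x, X n x ^ 2) / τ) + B ^ 2 * (∫ x, dm j x ^ 2) * τ) := by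
    filter_upwards [h.eventually_isTest ha c] with n hn
    have hzero : ∀ i, ∑ j, (∫ x, A n i j x + D n i j x) = 0 := by
      intro i
      rw [← h.eqn i _ (hn i).1]
      refine Finset.sum_congr rfl fun j _ => ?_
      congr 1
      ext x
      rw [(hn i).2 j x, mul_add]
      rfl
    have hneg : ∑ i, ∑ j, ∫ x, D n i j x = -∑ i, ∑ j, ∫ x, A n i j x := by
      rw [eq_neg_iff_add_eq_zero, ← Finset.sum_add_distrib]
      refine Finset.sum_eq_zero fun i _ => ?_
      rw [← Finset.sum_add_distrib, ← hzero i]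
      refine Finset.sum_congr rfl fun j _ => ?_
      rw [integral_add (hAint n i j) (hDint n i j), add_comm]
    rw [hneg, abs_neg]
    refine (Finset.abs_sum_le_sum_abs _ _).trans (Finset.sum_le_sum fun i _ => ?_)
    exact (Finset.abs_sum_le_sum_abs _ _).trans (Finset.sum_le_sum fun j _ => hAle n i j)
  have hlimL := (tendsto_finsetSum Finset.univ fun i _ =>
    tendsto_finsetSum Finset.univ fun j _ => hDlim i j).abs
  have hlimR : Filter.Tendsto (fun n => ∑ _i : Fin 3, ∑ j,
      (B ^ 2 * ((∫ x, X n x ^ 2) / τ) + B ^ 2 * (∫ x, dm j x ^ 2) * τ)) Filter.atTop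
      (𝓝 (∑ _i : Fin 3, ∑ j, (B ^ 2 * ((∫ x, (m x * (c / (1 + (c * m x) ^ 2))) ^ 2) / τ) +
        B ^ 2 * (∫ x, dm j x ^ 2) * τ))) :=
    tendsto_finsetSum Finset.univ fun i _ => tendsto_finsetSum Finset.univ fun j _ =>
      ((hXlim.div_const τ).const_mul _).add_const _
  refine (le_of_tendsto_of_tendsto hlimL hlimR hev).trans (le_of_eq ?_)
  simp only [Finset.sum_add_distrib, Finset.sum_mul]

theorem aestronglyMeasurable_truncDeriv (h : IsDivFree Ω m dm u du) (a : ℝ) (i j : Fin 3) :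
    AEStronglyMeasurable (fun x => truncDeriv a (fun k => u k x) (fun k => du k j x) i)
      volume := by
  have h1 : AEMeasurable (fun x => ((fun k => u k x), fun k => du k j x)) volume :=
    AEMeasurable.prodMk (aemeasurable_pi_lambda _ fun k => (h.continuous_u k).aemeasurable)
      (aemeasurable_pi_lambda _ fun k => (h.bddExt_du k j).aestronglyMeasurable.aemeasurable)
  exact ((continuous_truncDeriv a i).measurable.comp_aemeasurable h1).aestronglyMeasurable

/-- The squares of `n m / (1 + (n m)²)` are bounded by `1` and tend to zero pointwise. -/
theorem tendsto_integral_sq_zero (h : IsDivFree Ω m dm u du) :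
    Filter.Tendsto (fun n : ℕ => ∫ x, (m x * ((n : ℝ) / (1 + ((n : ℝ) * m x) ^ 2))) ^ 2)
      Filter.atTop (𝓝 0) := by
  have hmm := h.bddExt_m.aestronglyMeasurable
  have hpos : ∀ t : ℝ, (0 : ℝ) < 1 + t ^ 2 := fun t => by positivity
  rw [← integral_zero E3 ℝ (μ := volume)]
  have hone : ∀ (n : ℕ) (t : ℝ), |t * ((n : ℝ) / (1 + ((n : ℝ) * t) ^ 2))| ≤ 1 := fun n t => by
    rw [← mul_div_assoc, abs_div, abs_of_pos (hpos _), div_le_one (hpos _), mul_comm]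
    nlinarith [sq_nonneg (|(n : ℝ) * t| - 1), sq_abs ((n : ℝ) * t), abs_nonneg ((n : ℝ) * t)]
  refine tendsto_integral_of_dominated_convergence ((Ω : Set E3).indicator fun _ => 1)
    (fun n => ?_) ?_ (fun n => Filter.Eventually.of_forall fun x => ?_)
    (Filter.Eventually.of_forall fun x => ?_)
  · have : Continuous fun t : ℝ => t * ((n : ℝ) / (1 + ((n : ℝ) * t) ^ 2)) :=
      continuous_id.mul (continuous_const.div (by fun_prop) fun t => (hpos _).ne')
    exact (this.comp_aestronglyMeasurable hmm).pow 2
  · rw [integrable_indicator_iff Ω.isOpen.measurableSet]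
    exact integrableOn_const h.isBounded.measure_lt_top.ne
  · rw [Real.norm_of_nonneg (sq_nonneg _)]
    by_cases hx : x ∈ (Ω : Set E3)
    · rw [indicator_of_mem hx, ← sq_abs]
      exact pow_le_one₀ (abs_nonneg _) (hone n _)
    · rw [indicator_of_notMem hx, h.bddExt_m.eq_zero x hx]
      simp
  · have hlim : Filter.Tendsto (fun n : ℕ => m x * ((n : ℝ) / (1 + ((n : ℝ) * m x) ^ 2)))
        Filter.atTop (𝓝 0) := by
      by_cases hm0 : m x = 0
      · simp [hm0]
      refine squeeze_zero_norm (a := fun n : ℕ => |m x|⁻¹ * (n : ℝ)⁻¹) (fun n => ?_) ?_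
      · rcases Nat.eq_zero_or_pos n with hn | hn
        · simp [hn]
        · have hn' : (0 : ℝ) < n := by exact_mod_cast hn
          have hmp : 0 < |m x| := abs_pos.2 hm0
          rw [Real.norm_eq_abs, ← mul_div_assoc, abs_div, abs_of_pos (hpos _), ← mul_inv,
            ← one_div, div_le_div_iff₀ (hpos _) (by positivity), abs_mul, abs_of_pos hn', mul_pow,
            ← sq_abs (m x)]
          nlinarith
      · simpa using (tendsto_inv_atTop_nhds_zero_nat (𝕜 := ℝ)).const_mul |m x|⁻¹
    simpa using hlim.pow 2

/-- The absolute value `|m|` solves the same equation as `m`, tested here against the truncations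
of `u`: this is the limit `c → ∞`, where `arctan (c m)` tends to a multiple of the sign of `m`. -/
theorem sum_integral_abs_truncDeriv (h : IsDivFree Ω m dm u du) {a : ℝ} (ha : 0 < a) :
    ∑ i, ∑ j, ∫ x, |m x| * eps du i j x *
      truncDeriv a (fun k => u k x) (fun k => du k j x) i = 0 := by
  obtain ⟨W, E, hWE⟩ := h.exists_abs_sum_integral_le
  obtain ⟨B, -, -, -, hBd⟩ := h.exists_common_bound
  obtain ⟨C, hC0, hC⟩ := exists_abs_truncDeriv_le
  have hmm := h.bddExt_m.aestronglyMeasurable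
  have hlim : ∀ i j, Filter.Tendsto (fun n : ℕ => ∫ x, m x * eps du i j x *
      (Real.arctan ((n : ℝ) * m x) * truncDeriv a (fun k => u k x) (fun k => du k j x) i))
      Filter.atTop (𝓝 (∫ x, m x * eps du i j x * (Real.pi / 2 * Real.sign (m x) *
        truncDeriv a (fun k => u k x) (fun k => du k j x) i))) := by
    intro i j
    refine tendsto_integral_of_dominated_convergence
      (fun x => |m x * eps du i j x| * (2 * (C * ∑ _k : Fin 3, B)))
      (fun n => ?_) ((h.integrable_mul_eps i j).abs.mul_const _)
      (fun n => Filter.Eventually.of_forall fun x => ?_)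
      (Filter.Eventually.of_forall fun x => ?_)
    · refine (h.integrable_mul_eps i j).aestronglyMeasurable.mul
        (AEStronglyMeasurable.mul ?_ (h.aestronglyMeasurable_truncDeriv a i j))
      exact (Real.continuous_arctan.comp (continuous_const.mul continuous_id)
        ).comp_aestronglyMeasurable hmm
    · rw [Real.norm_eq_abs, abs_mul]
      refine mul_le_mul_of_nonneg_left ?_ (abs_nonneg _)
      rw [abs_mul]
      refine mul_le_mul (abs_arctan_le_two _) ((hC a _ _ i ha.le).trans ?_) (abs_nonneg _)
        (by simp)
      exact mul_le_mul_of_nonneg_left (Finset.sum_le_sum fun k _ => hBd k j x) hC0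
    · exact ((tendsto_arctan_mul_nat _).mul_const _).const_mul _
  have hsum := (tendsto_finsetSum Finset.univ fun i _ =>
    tendsto_finsetSum Finset.univ fun j _ => hlim i j).abs
  set I := ∑ i, ∑ j, ∫ x, m x * eps du i j x * (Real.pi / 2 * Real.sign (m x) *
        truncDeriv a (fun k => u k x) (fun k => du k j x) i) with hI
  have hbound : ∀ τ : ℝ, 0 < τ → |I| ≤ E * τ := by
    intro τ hτ
    have hr : Filter.Tendsto (fun n : ℕ =>
        W * ((∫ x, (m x * ((n : ℝ) / (1 + ((n : ℝ) * m x) ^ 2))) ^ 2) / τ) + E * τ)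
        Filter.atTop (𝓝 (W * (0 / τ) + E * τ)) :=
      ((h.tendsto_integral_sq_zero.div_const τ).const_mul W).add_const _
    have := le_of_tendsto_of_tendsto' hsum hr fun n => hWE a n τ ha hτ
    simpa using this
  have hI0 : I = 0 := by
    by_contra hne
    have hp : 0 < |I| := abs_pos.2 hne
    have hE : 0 < |E| + 1 := by positivity
    have h1 := hbound (|I| / (2 * (|E| + 1))) (by positivity)
    have h2 : E * (|I| / (2 * (|E| + 1))) ≤ (|E| + 1) * (|I| / (2 * (|E| + 1))) := by
      gcongr
      linarith [le_abs_self E]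
    have h3 : (|E| + 1) * (|I| / (2 * (|E| + 1))) = |I| / 2 := by field_simp
    linarith
  have hfactor : I = Real.pi / 2 * ∑ i, ∑ j, ∫ x, |m x| * eps du i j x *
      truncDeriv a (fun k => u k x) (fun k => du k j x) i := by
    simp only [hI, Finset.mul_sum, ← integral_const_mul]
    refine Finset.sum_congr rfl fun i _ => Finset.sum_congr rfl fun j _ => ?_
    congr 1
    ext x
    rw [← mul_sign_eq_abs]
    ring
  rw [hfactor] at hI0
  exact (mul_eq_zero.1 hI0).resolve_left (by positivity)

/-- The energy identity `∫ |m| |ε(u)|² = 0` on the set where `u` does not vanish, obtained by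
removing the truncation; in pointwise form. -/
theorem mul_eps_eq_zero_of_ne_zero (h : IsDivFree Ω m dm u du) {x : E3} (hx : x ∈ Ω)
    (hux : ∑ k, u k x ^ 2 ≠ 0) (i j : Fin 3) : m x * eps du i j x = 0 := by
  obtain ⟨B, -, -, -, hBd⟩ := h.exists_common_bound
  obtain ⟨C, hC0, hC⟩ := exists_abs_truncDeriv_le
  set V : Set E3 := {x | ∑ k, u k x ^ 2 ≠ 0} with hV
  have hVo : IsOpen V := isOpen_ne_fun
    (continuous_finsetSum _ fun k _ => (h.continuous_u k).pow 2) continuous_const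
  have hme : ∀ i j, Integrable fun x => |m x| * eps du i j x := fun i j => by
    have hm := (h.integrable_mul_eps i j)
    refine hm.mono ?_ (Filter.Eventually.of_forall fun x => ?_)
    · refine h.bddExt_m.aestronglyMeasurable.norm.mul ?_
      exact (((h.bddExt_du i j).aestronglyMeasurable.add
        (h.bddExt_du j i).aestronglyMeasurable).mul_const (2⁻¹ : ℝ)).congr
        (Filter.Eventually.of_forall fun x => (div_eq_mul_inv _ _).symm)
    · rw [norm_mul, norm_mul, Real.norm_eq_abs, Real.norm_eq_abs, abs_abs]; rfl
  have hdi : ∀ i j, Integrable fun x => |m x| * eps du i j x * du i j x := fun i j =>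
    (hme i j).mul_bdd (c := B) (h.bddExt_du i j).aestronglyMeasurable
      (Filter.Eventually.of_forall fun x => hBd i j x)
  have hlim : ∀ i j, Filter.Tendsto (fun n : ℕ => ∫ x, |m x| * eps du i j x *
      truncDeriv ((n : ℝ) + 1) (fun k => u k x) (fun k => du k j x) i)
      Filter.atTop (𝓝 (∫ x, V.indicator (fun x => |m x| * eps du i j x * du i j x) x)) := by
    intro i j
    refine tendsto_integral_of_dominated_convergence
      (fun x => ‖|m x| * eps du i j x‖ * (C * ∑ _k : Fin 3, B))
      (fun n => ?_) ((hme i j).norm.mul_const _)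
      (fun n => Filter.Eventually.of_forall fun x => ?_)
      (Filter.Eventually.of_forall fun x => ?_)
    · exact (hme i j).aestronglyMeasurable.mul (h.aestronglyMeasurable_truncDeriv _ i j)
    · rw [norm_mul]
      refine mul_le_mul_of_nonneg_left ((hC _ _ _ i (by positivity)).trans ?_) (norm_nonneg _)
      exact mul_le_mul_of_nonneg_left (Finset.sum_le_sum fun k _ => hBd k j x) hC0
    · refine tendsto_const_nhds.congr' ?_
      by_cases hxV : x ∈ V
      · have hpos : 0 < ∑ k, u k x ^ 2 :=
          lt_of_le_of_ne (Finset.sum_nonneg fun k _ => sq_nonneg _) (Ne.symm hxV)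
        have ht : Filter.Tendsto (fun n : ℕ => ((n : ℝ) + 1) * ∑ k, u k x ^ 2) Filter.atTop
            Filter.atTop :=
          (Filter.tendsto_atTop_add_const_right _ _ tendsto_natCast_atTop_atTop
            ).atTop_mul_const hpos
        filter_upwards [ht.eventually_gt_atTop 2] with n hn
        rw [truncDeriv_eq_self hn, indicator_of_mem hxV]
      · refine Filter.Eventually.of_forall fun n => ?_
        have h0 : ∑ k, u k x ^ 2 = 0 := not_not.1 hxV
        simp only
        rw [truncDeriv_eq_zero (by rw [h0]; simp), indicator_of_notMem hxV, mul_zero]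
  have hzero : ∑ i, ∑ j, ∫ x, V.indicator (fun x => |m x| * eps du i j x * du i j x) x = 0 := by
    refine tendsto_nhds_unique (tendsto_finsetSum Finset.univ fun i _ =>
      tendsto_finsetSum Finset.univ fun j _ => hlim i j) ?_
    simp only [h.sum_integral_abs_truncDeriv (Nat.cast_add_one_pos _)]
    exact tendsto_const_nhds
  have hind : ∀ i j, Integrable (V.indicator fun x => |m x| * eps du i j x * du i j x) :=
    fun i j => (hdi i j).indicator hVo.measurableSet
  -- By symmetry of the strain, pairing it with the gradient gives the square of its norm.
  have hsq : ∀ x, ∑ i, ∑ j, V.indicator (fun x => |m x| * eps du i j x * du i j x) x =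
      V.indicator (fun x => |m x| * ∑ i, ∑ j, eps du i j x ^ 2) x := by
    intro x
    by_cases hxV : x ∈ V
    · simp only [indicator_of_mem hxV, eps, Fin.sum_univ_three]
      ring
    · simp only [indicator_of_notMem hxV, Finset.sum_const_zero]
  have hint0 : ∫ x, V.indicator (fun x => |m x| * ∑ i, ∑ j, eps du i j x ^ 2) x = 0 := by
    rw [← hzero]
    simp only [← hsq]
    rw [integral_finsetSum _ fun i _ => integrable_finsetSum _ fun j _ => hind i j]
    exact Finset.sum_congr rfl fun i _ => integral_finsetSum _ fun j _ => hind i j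
  have hae := (integral_eq_zero_iff_of_nonneg (fun x => indicator_nonneg (fun x _ =>
    mul_nonneg (abs_nonneg _) (Finset.sum_nonneg fun i _ => Finset.sum_nonneg fun j _ =>
      sq_nonneg _)) x) (by
      simp only [← hsq]
      exact integrable_finsetSum _ fun i _ => integrable_finsetSum _ fun j _ => hind i j)).1 hint0
  have hPo : IsOpen (V ∩ (Ω : Set E3)) := hVo.inter Ω.isOpen
  have hcont : ContinuousOn (fun x => |m x| * ∑ i, ∑ j, eps du i j x ^ 2) (V ∩ (Ω : Set E3)) := by
    refine ContinuousOn.mul (h.bddExt_m.continuousOn.mono inter_subset_right).abs ?_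
    refine continuousOn_finsetSum _ fun i _ => continuousOn_finsetSum _ fun j _ => ?_
    exact ((((h.bddExt_du i j).continuousOn.add (h.bddExt_du j i).continuousOn).div_const 2).pow
      2).mono inter_subset_right
  have heq := Measure.eqOn_open_of_ae_eq (μ := volume) (g := fun _ => (0 : ℝ)) (by
    filter_upwards [ae_restrict_of_ae hae, ae_restrict_mem hPo.measurableSet] with y hy hyV
    rwa [indicator_of_mem hyV.1] at hy) hPo hcont continuousOn_const
  have hx0 : |m x| * ∑ i, ∑ j, eps du i j x ^ 2 = 0 := heq ⟨hux, hx⟩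
  rcases mul_eq_zero.1 hx0 with h0 | h0
  · rw [abs_eq_zero.1 h0, zero_mul]
  · have h1 := (Finset.sum_eq_zero_iff_of_nonneg fun i _ =>
      Finset.sum_nonneg fun j _ => sq_nonneg _).1 h0 i (Finset.mem_univ i)
    have h2 := (Finset.sum_eq_zero_iff_of_nonneg fun j _ => sq_nonneg _).1 h1 j (Finset.mem_univ j)
    rw [pow_eq_zero_iff two_ne_zero] at h2
    rw [h2, mul_zero]

/-- A weak derivative vanishes on open sets where the function vanishes. -/
theorem du_eq_zero_of_eventually (h : IsDivFree Ω m dm u du) {x : E3} (hx : x ∈ Ω)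
    (hu : ∀ᶠ y in 𝓝 x, ∀ k, u k y = 0) (i j : Fin 3) : du i j x = 0 := by
  obtain ⟨U, hUs, hUo, hxU⟩ := mem_nhds_iff.1 (Filter.inter_mem hu (Ω.isOpen.mem_nhds hx))
  have hae := ae_eq_of_integral_test_eq (U := ⟨U, hUo⟩) (f := du i j) (g := fun _ => 0)
    ((h.bddExt_du i j).integrable h.isBounded).locallyIntegrable
    (locallyIntegrable_const 0) fun φ hφ => by
      have hφΩ : IsTest Ω φ := ⟨hφ.contDiff, hφ.hasCompactSupport,
        hφ.tsupport_subset.trans fun y hy => (hUs hy).2⟩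
      have := h.deriv_u i j φ hφΩ
      have hz : ∀ y, u i y * fderiv ℝ φ y (basisVec j) = 0 := fun y => by
        by_cases hy : y ∈ U
        · rw [(hUs hy).1 i, zero_mul]
        · rw [fderiv_of_notMem_tsupport ℝ fun h' => hy (hφ.tsupport_subset h')]
          simp
      simp only [hz, integral_zero] at this
      simp only [zero_mul, integral_zero]
      linarith
  have heq := Measure.eqOn_open_of_ae_eq (μ := volume) (f := du i j) (g := fun _ => (0 : ℝ)) (by
    filter_upwards [ae_restrict_of_ae hae, ae_restrict_mem hUo.measurableSet] with y hy hyU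
    exact hy hyU) hUo ((h.bddExt_du i j).continuousOn.mono fun y hy => (hUs hy).2)
    continuousOn_const
  exact heq hxU

/-- If `∇·(m ε(u)) = 0` in `Ω` and `u = 0` on the boundary, then `m ε(u) = 0` in `Ω`. -/
theorem mul_eps_eq_zero (h : IsDivFree Ω m dm u du) {x : E3} (hx : x ∈ Ω) (i j : Fin 3) :
    m x * eps du i j x = 0 := by
  by_cases hev : ∀ᶠ y in 𝓝 x, ∀ k, u k y = 0
  · rw [eps, h.du_eq_zero_of_eventually hx hev, h.du_eq_zero_of_eventually hx hev]
    simp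
  · by_contra hne
    have hc : ContinuousAt (fun y => m y * eps du i j y) x :=
      (h.bddExt_m.continuousAt hx).mul
        ((((h.bddExt_du i j).continuousAt hx).add ((h.bddExt_du j i).continuousAt hx)).div_const 2)
    refine hev ?_
    filter_upwards [hc.eventually_ne hne, Ω.isOpen.mem_nhds hx] with y hy hyΩ k
    by_contra hk
    refine hy (h.mul_eps_eq_zero_of_ne_zero hyΩ (fun h0 => hk ?_) i j)
    have := (Finset.sum_eq_zero_iff_of_nonneg fun k _ => sq_nonneg _).1 h0 k (Finset.mem_univ k)
    exact pow_eq_zero_iff two_ne_zero |>.1 this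

end IsDivFree

/-! ### Application to the linearized operator -/

section Operator

variable {Ω : Opens E3} {k : ℕ}

theorem integrableOn_mul_strain (m : L2 Ω) (u : VecSobolev Ω k) (i j : Fin 3) :
    Integrable (fun x => m x * strain u i j x) (volume.restrict (Ω : Set E3)) :=
  (Lp.memLp m).integrable_mul (Lp.memLp (strain u i j))

theorem divScaledStrain_mk (m : L2 Ω) (u : VecSobolev Ω k) (i : Fin 3) {φ : E3 → ℝ}
    (h : IsTest Ω φ) :
    divScaledStrain m u i ⟨φ, h.contDiff, h.hasCompactSupport, h.tsupport_subset⟩ =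
      -∑ j, ∫ x in (Ω : Set E3), m x * strain u j i x * fderiv ℝ φ x (basisVec j) := by
  have hs : ∀ j, distDeriv j (toDist Ω fun x => m x * strain u j i x)
      ⟨φ, h.contDiff, h.hasCompactSupport, h.tsupport_subset⟩ =
      -∫ x in (Ω : Set E3), m x * strain u j i x * fderiv ℝ φ x (basisVec j) := fun j =>
    distDeriv_toDist_mk
      ((integrableOn_mul_strain m u j i).locallyIntegrable.locallyIntegrableOn _) j h
  rw [← Finset.sum_neg_distrib, ← Finset.sum_congr rfl fun j _ => hs j, divScaledStrain,
    Fin.sum_univ_three, Fin.sum_univ_three]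
  rfl

theorem distribution_ext {S T : 𝓓'(Ω, ℝ)} (hST : ∀ φ (h : IsTest Ω φ),
    S ⟨φ, h.contDiff, h.hasCompactSupport, h.tsupport_subset⟩ =
      T ⟨φ, h.contDiff, h.hasCompactSupport, h.tsupport_subset⟩) : S = T := by
  ext φ
  exact hST φ ⟨φ.contDiff, φ.hasCompactSupport, φ.tsupport_subset⟩

theorem divScaledStrain_sub (m m' : L2 Ω) (u : VecSobolev Ω k) (i : Fin 3)
    (he : divScaledStrain m u i = divScaledStrain m' u i) :
    divScaledStrain (m - m') u i = 0 := by
  refine distribution_ext fun φ h => ?_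
  have h1 := congrArg (fun T : 𝓓'(Ω, ℝ) =>
    T ⟨φ, h.contDiff, h.hasCompactSupport, h.tsupport_subset⟩) he
  simp only [divScaledStrain_mk _ _ _ h, neg_inj] at h1
  rw [divScaledStrain_mk _ _ _ h]
  have hi : ∀ (m : L2 Ω) j, Integrable (fun x => m x * strain u j i x *
      fderiv ℝ φ x (basisVec j)) (volume.restrict (Ω : Set E3)) := fun m j => by
    obtain ⟨C, -, hC⟩ := (h.fderiv_apply (basisVec j)).exists_bound
    exact (integrableOn_mul_strain m u j i).mul_bdd
      (h.fderiv_apply (basisVec j)).continuous.aestronglyMeasurable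
      (Filter.Eventually.of_forall hC)
  have h2 : ∀ j, ∫ x in (Ω : Set E3), (m - m' : L2 Ω) x * strain u j i x *
      fderiv ℝ φ x (basisVec j) =
      (∫ x in (Ω : Set E3), m x * strain u j i x * fderiv ℝ φ x (basisVec j)) -
      ∫ x in (Ω : Set E3), m' x * strain u j i x * fderiv ℝ φ x (basisVec j) := fun j => by
    rw [← integral_sub (hi m j) (hi m' j)]
    refine integral_congr_ae ?_
    filter_upwards [Lp.coeFn_sub m m'] with x hx
    rw [hx, Pi.sub_apply]
    ring
  simp only [h2, Finset.sum_sub_distrib, h1, sub_self, neg_zero]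
  rfl

theorem weakDeriv_zero (hb : Bornology.IsBounded (Ω : Set E3)) (i : Fin 3) :
    weakDeriv i (0 : L2 Ω) = 0 :=
  (isWeakDeriv_weakDeriv (k := 0) (Submodule.zero_mem _) i).hasWeakDirDeriv.unique hb
    (isWeakDeriv_zero i).hasWeakDirDeriv

theorem divScaledStrain_zero_left (u : VecSobolev Ω k) (i : Fin 3) :
    divScaledStrain (0 : L2 Ω) u i = 0 := by
  simpa using divScaledStrain_sub (0 : L2 Ω) 0 u i rfl

theorem divScaledStrain_zero_right (hb : Bornology.IsBounded (Ω : Set E3)) (m : L2 Ω)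
    (i : Fin 3) : divScaledStrain m (0 : VecSobolev Ω k) i = 0 := by
  refine distribution_ext fun φ h => ?_
  rw [divScaledStrain_mk _ _ _ h]
  have hs : ∀ j, strain (0 : VecSobolev Ω k) j i = 0 := fun j => by
    simp [strain, weakDeriv_zero hb]
  have h2 : ∀ j, ∫ x in (Ω : Set E3), m x * strain (0 : VecSobolev Ω k) j i x *
      fderiv ℝ φ x (basisVec j) = 0 := fun j => by
    refine integral_eq_zero_of_ae ?_
    rw [hs]
    filter_upwards [Lp.coeFn_zero ℝ 2 (volume.restrict (Ω : Set E3))] with x hx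
    rw [hx]
    simp
  simp only [h2, Finset.sum_const_zero, neg_zero]
  rfl

theorem boundaryOp_zero : boundaryOp (0 : VecSobolev Ω k) = 0 := by
  ext x i
  exact pointValue_zero _

theorem HasWeakDirDeriv.congr_ae {v : E3} {f f' g g' : E3 → ℝ}
    (h : HasWeakDirDeriv Ω v f g) (hf : f =ᵐ[volume] f') (hg : g =ᵐ[volume] g') :
    HasWeakDirDeriv Ω v f' g' := by
  intro φ hφ
  have h1 : ∫ x, f' x * fderiv ℝ φ x v = ∫ x, f x * fderiv ℝ φ x v :=
    integral_congr_ae (by filter_upwards [hf] with x hx; rw [hx])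
  have h2 : ∫ x, g' x * φ x = ∫ x, g x * φ x :=
    integral_congr_ae (by filter_upwards [hg] with x hx; rw [hx])
  rw [h1, h2, h φ hφ]

/-- If `∇·(m ε(u)) = 0` on `Ω` and `u = 0` on the boundary, for `m ∈ H³` and `u ∈ H⁴`, then
`m ε(u)` vanishes at every point of `Ω`. -/
theorem pointValue_mul_strainAt_eq_zero (hb : Bornology.IsBounded (Ω : Set E3)) {r : ℕ}
    (hr : 1 ≤ r) (hbdry : HasCkBoundary r Ω) {l : ℕ} (hl : 2 ≤ l) {m : L2 Ω}
    (hm : m ∈ sobolev Ω (l + 1)) (u : VecSobolev Ω (l + 2)) (hu : boundaryOp u = 0)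
    (heq : ∀ i, divScaledStrain m u i = 0) {x : E3} (hx : x ∈ Ω) (i j : Fin 3) :
    pointValue m x * strainAt u x i j = 0 := by
  have hm3 : m ∈ sobolev Ω 3 := sobolev_antitone (by omega) hm
  have hu3 : ∀ i, (u i : L2 Ω) ∈ sobolev Ω 3 := fun i => sobolev_antitone (by omega) (u i).2
  have hd3 : ∀ i j, weakDeriv j (u i : L2 Ω) ∈ sobolev Ω 3 := fun i j =>
    sobolev_antitone (by omega) (weakDeriv_mem hb (k := l + 1) (u i).2 j)
  let du : Fin 3 → Fin 3 → E3 → ℝ := fun i j => pointExt (weakDeriv j (u i : L2 Ω))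
  have hae : ∀ {f : L2 Ω}, f ∈ sobolev Ω 3 → zeroExt f =ᵐ[volume] pointExt f := fun hf =>
    zeroExt_ae_eq_pointExt hb hr hbdry hf
  have hstrain : ∀ i j, ∀ᵐ y, y ∈ (Ω : Set E3) → strain u i j y = IsDivFree.eps du i j y := by
    intro i j
    filter_upwards [(ae_restrict_iff' Ω.isOpen.measurableSet).1 (Lp.coeFn_smul (1 / 2 : ℝ)
        (weakDeriv i (u j : L2 Ω) + weakDeriv j (u i : L2 Ω))),
      (ae_restrict_iff' Ω.isOpen.measurableSet).1
        (Lp.coeFn_add (weakDeriv i (u j : L2 Ω)) (weakDeriv j (u i : L2 Ω))),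
      hae (hd3 i j), hae (hd3 j i)] with y h1 h2 h3 h4 hy
    rw [zeroExt, indicator_of_mem hy] at h3 h4
    rw [strain, h1 hy, Pi.smul_apply, h2 hy, Pi.add_apply, h3, h4, IsDivFree.eps, smul_eq_mul]
    simp only [du]
    ring
  have hfree : IsDivFree Ω (pointExt m) (fun j => zeroExt (weakDeriv j m))
      (fun i => pointExt (u i : L2 Ω)) du := by
    refine ⟨hb, isBddExt_pointExt hb hr hbdry hm3, fun j => zeroExt_memLp _, fun j => ?_,
      fun i => isBddExt_pointExt hb hr hbdry (hu3 i), fun i => ?_,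
      fun i j => isBddExt_pointExt hb hr hbdry (hd3 i j), fun i j => ?_, fun i φ hφ => ?_⟩
    · exact (isWeakDeriv_weakDeriv hm j).hasWeakDirDeriv.congr_ae (hae hm3) Filter.EventuallyEq.rfl
    · exact continuous_pointExt hb hr hbdry (hu3 i) fun y hy => congrFun (congrFun hu ⟨y, hy⟩) i
    · exact (isWeakDeriv_weakDeriv (u i).2 j).hasWeakDirDeriv.congr_ae (hae (hu3 i))
        (hae (hd3 i j))
    · have h1 := congrArg (fun T : 𝓓'(Ω, ℝ) =>
        T ⟨φ, hφ.contDiff, hφ.hasCompactSupport, hφ.tsupport_subset⟩) (heq i)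
      simp only [divScaledStrain_mk _ _ _ hφ] at h1
      have h2 : -∑ j, ∫ x in (Ω : Set E3), m x * strain u j i x * fderiv ℝ φ x (basisVec j) =
        0 := h1
      rw [neg_eq_zero] at h2
      rw [← h2]
      refine Finset.sum_congr rfl fun j _ => ?_
      rw [← integral_indicator Ω.isOpen.measurableSet]
      refine integral_congr_ae ?_
      filter_upwards [hae hm3, hstrain j i] with y h3 h4
      by_cases hy : y ∈ (Ω : Set E3)
      · rw [zeroExt, indicator_of_mem hy] at h3
        rw [indicator_of_mem hy, h4 hy, h3, IsDivFree.eps, add_comm (du j i y)]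
      · rw [indicator_of_notMem hy, pointExt_of_notMem _ hy]
        simp
  have hpv : strainAt u x i j = IsDivFree.eps du i j x := by
    refine pointValue_eq_of_ae_eq hb (subset_closure hx) Filter.univ_mem ?_ ?_
    · exact (((hfree.bddExt_du i j).continuousAt hx).add
        ((hfree.bddExt_du j i).continuousAt hx)).div_const 2
    · filter_upwards [hstrain i j] with y hy hyΩ _ using hy hyΩ
  rw [hpv, ← pointExt_of_mem m hx]
  exact hfree.mul_eps_eq_zero hx i j

/-- The coefficient `m` is determined by the two divergences `∇·(m ε(u₁))` and `∇·(m ε(u₂))` if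
at each point one of the strains is nonsingular. -/
theorem eq_of_divScaledStrain_eq (hb : Bornology.IsBounded (Ω : Set E3)) {r : ℕ}
    (hr : 1 ≤ r) (hbdry : HasCkBoundary r Ω) {l : ℕ} (hl : 2 ≤ l) {m m' : sobolev Ω (l + 1)}
    (u₁ u₂ : VecSobolev Ω (l + 2)) (hu₁ : boundaryOp u₁ = 0) (hu₂ : boundaryOp u₂ = 0)
    (hstrain : ∀ x ∈ Ω, (strainAt u₁ x).det ≠ 0 ∨ (strainAt u₂ x).det ≠ 0)
    (h₁ : ∀ i, divScaledStrain (m : L2 Ω) u₁ i = divScaledStrain (m' : L2 Ω) u₁ i)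
    (h₂ : ∀ i, divScaledStrain (m : L2 Ω) u₂ i = divScaledStrain (m' : L2 Ω) u₂ i) : m = m' := by
  have hd : ((m - m' : sobolev Ω (l + 1)) : L2 Ω) ∈ sobolev Ω (l + 1) := (m - m').2
  have key : ∀ u : VecSobolev Ω (l + 2), boundaryOp u = 0 →
      (∀ i, divScaledStrain (m : L2 Ω) u i = divScaledStrain (m' : L2 Ω) u i) →
      ∀ x ∈ Ω, (strainAt u x).det ≠ 0 → pointValue ((m : L2 Ω) - (m' : L2 Ω)) x = 0 := by
    intro u hu h x hx hdet
    by_contra hne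
    refine hdet ?_
    have hz : strainAt u x = 0 := by
      ext i j
      exact (mul_eq_zero.1 (pointValue_mul_strainAt_eq_zero hb hr hbdry hl hd u hu
        (fun i => divScaledStrain_sub _ _ u i (h i)) hx i j)).resolve_left hne
    rw [hz, Matrix.det_zero]
  have hzero : ∀ x ∈ Ω, pointValue ((m : L2 Ω) - (m' : L2 Ω)) x = 0 := fun x hx =>
    (hstrain x hx).elim (key u₁ hu₁ h₁ x hx) (key u₂ hu₂ h₂ x hx)
  refine Subtype.ext (sub_eq_zero.1 ?_)
  rw [← zeroExt_ae_eq_iff]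
  have h3 : ((m : L2 Ω) - (m' : L2 Ω)) ∈ sobolev Ω 3 := sobolev_antitone (by omega) hd
  filter_upwards [zeroExt_ae_eq_pointExt hb hr hbdry h3,
    (ae_restrict_iff' Ω.isOpen.measurableSet).1 (Lp.coeFn_zero ℝ 2 _)] with x hx hx0
  by_cases hxΩ : x ∈ (Ω : Set E3)
  · rw [hx, pointExt_of_mem _ hxΩ, hzero x hxΩ, zeroExt, indicator_of_mem hxΩ, hx0 hxΩ]
    rfl
  · rw [zeroExt, zeroExt, indicator_of_notMem hxΩ, indicator_of_notMem hxΩ]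

end Operator

end Elastography

theorem corollary4p9 (l : ℕ) (hl : 3 < 2 * l)
    (Ω : TopologicalSpace.Opens Elastography.E3)
    (hbdd : Bornology.IsBounded (Ω : Set Elastography.E3))
    (hconn : IsConnected (Ω : Set Elastography.E3))
    (hbdry : Elastography.HasCkBoundary (l + 2) Ω)
    (lam : Elastography.L2 Ω) (mu : Elastography.sobolev Ω (l + 1))
    (F₁ F₂ : Fin 3 → Elastography.L2 Ω) (u₁ u₂ : Elastography.VecSobolev Ω (l + 2))
    (h₁ : Elastography.IsQuasiStaticDeformation lam (mu : Elastography.L2 Ω) F₁ u₁)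
    (h₂ : Elastography.IsQuasiStaticDeformation lam (mu : Elastography.L2 Ω) F₂ u₂)
    (hF : F₁ ≠ F₂) (hu : u₁ ≠ u₂)
    (hstrain : ∀ x ∈ Ω, (Elastography.strainAt u₁ x).det ≠ 0 ∨
      (Elastography.strainAt u₂ x).det ≠ 0) :
    {w : Elastography.Dom Ω l |
        Elastography.linearizedA2 (mu : Elastography.L2 Ω) u₁ u₂ w = 0} = {0} ∧
      Function.Injective (Elastography.linearizedA2 (l := l) (mu : Elastography.L2 Ω) u₁ u₂) := by
  have hinj : Function.Injective
      (Elastography.linearizedA2 (l := l) (mu : Elastography.L2 Ω) u₁ u₂) := by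
    rintro ⟨m, v₁, v₂⟩ ⟨m', v₁', v₂'⟩ h
    -- The operator records the fields themselves, so only the coefficient is in question.
    have e₁ : v₁ = v₁' := congrArg (fun z => z.1.1.2) h
    have e₂ : v₂ = v₂' := congrArg (fun z => z.2.1.2) h
    subst e₁ e₂
    have cancel : ∀ {S S' T : 𝓓'(Ω, ℝ)},
        (2 : ℝ) • S + (2 : ℝ) • T = (2 : ℝ) • S' + (2 : ℝ) • T → S = S' := fun h =>
      smul_right_injective _ (two_ne_zero (α := ℝ)) (add_right_cancel h)
    have hm : m = m' := Elastography.eq_of_divScaledStrain_eq hbdd (by omega) hbdry (by omega)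
      u₁ u₂ h₁.2 h₂.2 hstrain
      (fun i => cancel (congrFun (congrArg (fun z => z.1.1.1) h) i))
      (fun i => cancel (congrFun (congrArg (fun z => z.2.1.1) h) i))
    rw [hm]
  have hzero : Elastography.linearizedA2 (l := l) (mu : Elastography.L2 Ω) u₁ u₂ 0 = 0 := by
    have hz : ∀ u : Elastography.VecSobolev Ω (l + 2),
        Elastography.linearizedL (mu : Elastography.L2 Ω) u 0 0 = 0 := fun u => by
      refine Prod.ext (funext fun i => ?_) rfl
      change (2 : ℝ) • Elastography.divScaledStrain (0 : Elastography.L2 Ω) u i +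
        (2 : ℝ) • Elastography.divScaledStrain (mu : Elastography.L2 Ω)
          (0 : Elastography.VecSobolev Ω (l + 2)) i = 0
      rw [Elastography.divScaledStrain_zero_left,
        Elastography.divScaledStrain_zero_right hbdd]
      simp
    exact Prod.ext (Prod.ext (hz u₁) Elastography.boundaryOp_zero)
      (Prod.ext (hz u₂) Elastography.boundaryOp_zero)
  refine ⟨?_, hinj⟩
  ext w
  exact ⟨fun hw => hinj (hw.trans hzero.symm), fun hw => hw ▸ hzero⟩
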